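/- All graphs are finite, simple and undirected. For a graph $G$, $\delta(G)$ and $\Delta(G)$ denote its minimum and maximum degree, and $G$ is $k$-connected if it has more than $k$ vertices and $G-S$ is connected for every set $S$ of fewer than $k$ vertices (equivalently, its vertex connectivity $\kappa(G)$ is at least $k$). For a set $F$ of edges of $G$, $G-F$ is the graph on the same vertex set obtained by deleting the edges in $F$. Let $k \geq 2$, $p \geq 1$ and $q \geq 1$ be integers, and let $G$ be a $k$-connected graph of order $n$ with $\delta(G) \geq \frac{n}{2}$ and $$n \geq \max\left\{6(k+p)+8(q-1)-2\left\lceil \frac{k-2}{k} \right\rceil,\ k(q+3)+\max\{(k-2)q-2,\,2p\}+2\max\{p,q\}-4\right\}.$$ Then at least one of the following holds: 1. for every spanning subgraph $H$ of $G$ with $\Delta(H) \leq p$, the graph $G-E(H)$ is $k$-connected; 2. there are $q$ pairwise edge-disjoint Hamiltonian cycles $H_1,H_2,\ldots,H_q$ in $G$ such that $G-\bigcup_{1\leq i\leq q}E(H_i)$ is $k$-connected. -/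

import Mathlib

/-- `IsKConnected G k`: the finite graph `G` is `k`-connected, that is, `κ(G) ≥ k`.  It has more than
`k` vertices, and the graph `G - S` is connected for every set `S` of fewer than `k` vertices. -/
def IsKConnected {V : Type*} [Fintype V] (G : SimpleGraph V) (k : ℕ) : Prop :=
  k < Fintype.card V ∧
    ∀ S : Finset V, S.card < k → (G.induce {v : V | v ∉ S}).Connected

/-! Suppose that deleting some `H` of maximum degree at most `p` destroys `k`-connectedness. Then
fewer than `k` vertices `S` separate two sets `A` and `B` of `G - H`, and in `G` every vertex of `A`
has at most `p` neighbours in `B` and vice versa. As all degrees are at least `n / 2`, `A` and `B`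
are dense clusters of size about `n / 2`. Each vertex of `S` has at least `k + 2q` neighbours in one
of the clusters and can be attached to it; a set `X` of at most two vertices with at least `k + q`
neighbours in both clusters is set aside. This gives two sides `A ∪ SA` and `B ∪ SB`.

Hamiltonian cycles are built one at a time. Each side stays Hamilton-connected after the removal of
the cycles already built (`Layout.hasHamPath`, by Bondy–Chvátal closure), so a cycle needs only two
disjoint connections between the sides that together absorb `X` (`Connector`). Each cycle takes at
most two edges at a vertex, and one edge from a vertex of `X` to each cluster, so the surpluses `2q`
and `q` last for `q` cycles. What remains inside a cluster survives the deletion of any `T` with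
fewer than `k` vertices, and every vertex outside `T` still reaches a cluster. Hence only the link
between the clusters can fail (`Layout.isKConnected`), and it is protected by reserving a graph `Z`
of edges between the sides that no cycle may use.

If two vertices have at least `k + q` neighbours in both clusters, they form `X`, every cycle
crosses through them, and all edges between the sides are reserved. A set `T` missing part of `X`
leaves a linking vertex; otherwise the `k`-connectedness of `G` supplies a reserved edge avoiding
`T`.

If there is at most one such vertex, `X` consists of all of them. By König's theorem and
`k`-connectedness the sides are joined by a matching of `k - |X|` edges, which is reserved; a set
`T` containing `X` cannot meet all of it. The minimum degree gives every vertex of the smaller side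
a neighbour across, which leaves enough other edges for the connectors. -/

namespace SimpleGraph

variable {V : Type*}

/-! ### Degrees into a set, and Hamilton paths with fixed ends by degree closure. -/

open Classical in
/-- The neighbours of `v` that lie in the finite set `W`. -/
noncomputable def nbrsIn (G : SimpleGraph V) (W : Finset V) (v : V) : Finset V :=
  W.filter (G.Adj v)

@[simp]
lemma mem_nbrsIn {G : SimpleGraph V} {W : Finset V} {v w : V} :
    w ∈ G.nbrsIn W v ↔ w ∈ W ∧ G.Adj v w := by
  simp [nbrsIn]

/-- The number of neighbours of `v` in the finite set `W`. -/
noncomputable def degIn (G : SimpleGraph V) (W : Finset V) (v : V) : ℕ := (G.nbrsIn W v).card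

lemma degIn_mono {G G' : SimpleGraph V} {W W' : Finset V} {v : V} (h : G ≤ G') (hW : W ⊆ W') :
    G.degIn W v ≤ G'.degIn W' v := by
  refine Finset.card_le_card fun w hw => ?_
  rw [mem_nbrsIn] at hw ⊢
  exact ⟨hW hw.1, h hw.2⟩

lemma degIn_le_card {G : SimpleGraph V} {W : Finset V} {v : V} : G.degIn W v ≤ W.card :=
  Finset.card_le_card fun _ hw => (mem_nbrsIn.1 hw).1

/-- `G` has a path with vertex set `W` from `s` to `t`, given by an enumeration of `W`. -/
def HasHamPath (G : SimpleGraph V) (W : Finset V) (s t : V) : Prop :=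
  ∃ f : ℕ → V, (∀ i < W.card, f i ∈ W) ∧
    (∀ i j, i < W.card → j < W.card → f i = f j → i = j) ∧
    f 0 = s ∧ f (W.card - 1) = t ∧ ∀ i, i + 1 < W.card → G.Adj (f i) (f (i + 1))

/-- Reversing the segment `a + 1, ..., b` replaces the steps at `a` and `b` by the pairs `(a, b)`
and `(a + 1, b + 1)`, and keeps both ends of the path. -/
lemma HasHamPath.of_reverse_segment {G : SimpleGraph V} {W : Finset V} (f : ℕ → V)
    (hf : ∀ i < W.card, f i ∈ W)
    (hinj : ∀ i j, i < W.card → j < W.card → f i = f j → i = j) {a b : ℕ} (hab : a < b)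
    (hb : b + 1 < W.card) (h1 : G.Adj (f a) (f b)) (h2 : G.Adj (f (a + 1)) (f (b + 1)))
    (hadj : ∀ i, i + 1 < W.card → i ≠ a → i ≠ b → G.Adj (f i) (f (i + 1))) :
    G.HasHamPath W (f 0) (f (W.card - 1)) := by
  refine ⟨fun j => if a + 1 ≤ j ∧ j ≤ b then f (a + 1 + b - j) else f j, ?_, ?_, ?_, ?_, ?_⟩
  · intro i hi
    dsimp only
    split_ifs with h
    · exact hf _ (by omega)
    · exact hf _ hi
  · intro i j hi hj hij
    dsimp only at hij
    split_ifs at hij with h h' h'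
    · have := hinj _ _ (by omega) (by omega) hij; omega
    · have := hinj _ _ (by omega) (by omega) hij; omega
    · have := hinj _ _ (by omega) (by omega) hij; omega
    · exact hinj _ _ hi hj hij
  · simp
  · dsimp only
    rw [if_neg (by omega)]
  · intro i hi
    dsimp only
    by_cases hia : i = a
    · subst hia
      rw [if_neg (by omega), if_pos (by omega), show i + 1 + b - (i + 1) = b by omega]
      exact h1
    by_cases hib : i = b
    · subst hib
      rw [if_pos (by omega), if_neg (by omega), show a + 1 + i - i = a + 1 by omega]
      exact h2
    by_cases hin : a + 1 ≤ i ∧ i ≤ b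
    · rw [if_pos hin, if_pos (by omega)]
      have := hadj (a + 1 + b - (i + 1)) (by omega) (by omega) (by omega)
      rw [show a + 1 + b - (i + 1) + 1 = a + 1 + b - i by omega] at this
      exact this.symm
    · rw [if_neg hin, if_neg (by omega)]
      exact hadj i hi hia hib

variable [DecidableEq V]

lemma degIn_add_one_le_card {G : SimpleGraph V} {W : Finset V} {v : V} (hv : v ∈ W) :
    G.degIn W v + 1 ≤ W.card := by
  have : G.nbrsIn W v ⊆ W.erase v := fun w hw => by
    rw [mem_nbrsIn] at hw
    exact Finset.mem_erase.2 ⟨hw.2.ne', hw.1⟩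
  have h := Finset.card_le_card this
  rw [Finset.card_erase_of_mem hv] at h
  have := Finset.card_pos.2 ⟨v, hv⟩
  unfold degIn
  omega

lemma degIn_union_le {G : SimpleGraph V} {W W' : Finset V} {v : V} :
    G.degIn (W ∪ W') v ≤ G.degIn W v + G.degIn W' v := by
  refine le_trans (Finset.card_le_card fun w hw => ?_) (Finset.card_union_le _ _)
  simp only [mem_nbrsIn, Finset.mem_union] at hw ⊢
  tauto

lemma degIn_union_of_disjoint {G : SimpleGraph V} {W W' : Finset V} {v : V} (h : Disjoint W W') :
    G.degIn (W ∪ W') v = G.degIn W v + G.degIn W' v := by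
  unfold degIn
  rw [← Finset.card_union_of_disjoint]
  · congr 1
    ext w
    simp only [mem_nbrsIn, Finset.mem_union]
    tauto
  · rw [Finset.disjoint_left] at h ⊢
    intro w hw hw'
    exact h (mem_nbrsIn.1 hw).1 (mem_nbrsIn.1 hw').1

lemma degIn_sup_le {G G' : SimpleGraph V} {W : Finset V} {v : V} :
    (G ⊔ G').degIn W v ≤ G.degIn W v + G'.degIn W v := by
  refine le_trans (Finset.card_le_card fun w hw => ?_) (Finset.card_union_le _ _)
  simp only [mem_nbrsIn, Finset.mem_union, sup_adj] at hw ⊢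
  tauto

lemma degIn_le_sdiff_add {G D : SimpleGraph V} {W : Finset V} {v : V} :
    G.degIn W v ≤ (G \ D).degIn W v + D.degIn W v := by
  refine le_trans (Finset.card_le_card fun w hw => ?_) (Finset.card_union_le _ _)
  simp only [mem_nbrsIn, Finset.mem_union, sdiff_adj] at hw ⊢
  tauto

/-- Ore's rotation argument with fixed ends: one step of the enumeration may fail to be an edge, and
a large degree sum at its two vertices yields a segment whose reversal avoids that step. -/
lemma HasHamPath.of_missing_edge {G : SimpleGraph V} {W : Finset V} (f : ℕ → V)
    (hf : ∀ i < W.card, f i ∈ W)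
    (hinj : ∀ i j, i < W.card → j < W.card → f i = f j → i = j) {c : ℕ} (hc : c + 1 < W.card)
    (hadj : ∀ i, i + 1 < W.card → i ≠ c → G.Adj (f i) (f (i + 1)))
    (hdeg : W.card + 1 ≤ G.degIn W (f c) + G.degIn W (f (c + 1))) :
    G.HasHamPath W (f 0) (f (W.card - 1)) := by
  classical
  by_cases hcc : G.Adj (f c) (f (c + 1))
  · refine ⟨f, hf, hinj, rfl, rfl, fun i hi => ?_⟩
    by_cases h : i = c
    · subst h; exact hcc
    · exact hadj i hi h
  have himg : (Finset.range W.card).image f = W := by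
    apply Finset.eq_of_subset_of_card_le
    · intro v hv
      obtain ⟨i, hi, rfl⟩ := Finset.mem_image.1 hv
      exact hf i (Finset.mem_range.1 hi)
    · rw [Finset.card_image_of_injOn]
      · simp
      · intro i hi j hj hij
        exact hinj i j (by simpa using hi) (by simpa using hj) hij
  set I := (Finset.range (W.card - 1)).filter fun i => G.Adj (f c) (f i) with hI
  set J := (Finset.range (W.card - 1)).filter fun i => G.Adj (f (c + 1)) (f (i + 1)) with hJ
  -- Each index set misses one possible neighbour: `I` the last vertex of the path, `J` the first.
  have hIc : G.degIn W (f c) ≤ I.card + 1 := by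
    refine le_trans (Finset.card_le_card (t := insert (f (W.card - 1)) (I.image f)) ?_)
      ((Finset.card_insert_le _ _).trans (Nat.succ_le_succ Finset.card_image_le))
    intro v hv
    obtain ⟨hv, hv'⟩ := mem_nbrsIn.1 hv
    rw [← himg] at hv
    obtain ⟨i, hi, rfl⟩ := Finset.mem_image.1 hv
    rw [Finset.mem_range] at hi
    by_cases h : i = W.card - 1
    · rw [h]; exact Finset.mem_insert_self _ _
    · exact Finset.mem_insert_of_mem (Finset.mem_image_of_mem _ (by simp [hI, hv']; omega))
  have hJc : G.degIn W (f (c + 1)) ≤ J.card + 1 := by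
    refine le_trans
      (Finset.card_le_card (t := insert (f 0) (J.image fun i => f (i + 1))) ?_)
      ((Finset.card_insert_le _ _).trans (Nat.succ_le_succ Finset.card_image_le))
    intro v hv
    obtain ⟨hv, hv'⟩ := mem_nbrsIn.1 hv
    rw [← himg] at hv
    obtain ⟨i, hi, rfl⟩ := Finset.mem_image.1 hv
    rw [Finset.mem_range] at hi
    obtain _ | i := i
    · exact Finset.mem_insert_self _ _
    · exact Finset.mem_insert_of_mem (Finset.mem_image.2 ⟨i, by simp [hJ, hv']; omega, rfl⟩)
  have hsub : I ∪ J ⊆ (Finset.range (W.card - 1)).erase c := by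
    intro i hi
    rw [Finset.mem_union, hI, hJ, Finset.mem_filter, Finset.mem_filter] at hi
    rw [Finset.mem_erase]
    refine ⟨?_, by tauto⟩
    rintro rfl
    rcases hi with hi | hi
    · exact G.loopless.irrefl _ hi.2
    · exact G.loopless.irrefl _ hi.2
  have hcard := Finset.card_le_card hsub
  rw [Finset.card_erase_of_mem (by simp; omega), Finset.card_range] at hcard
  have hui := Finset.card_union_add_card_inter I J
  -- Pigeonhole: `I` and `J` have at least `W.card - 1` elements together, but their union avoids
  -- `c` and has at most `W.card - 2`.
  obtain ⟨i, hi⟩ : (I ∩ J).Nonempty := by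
    rw [← Finset.card_pos]
    omega
  have hic : i ≠ c := fun h => by
    have := hsub (Finset.mem_union_left _ (Finset.mem_inter.1 hi).1)
    simp [h] at this
  simp only [hI, hJ, Finset.mem_inter, Finset.mem_filter, Finset.mem_range] at hi
  obtain ⟨⟨hi0, hi1⟩, -, hi2⟩ := hi
  rcases lt_or_gt_of_ne hic with h | h
  · exact HasHamPath.of_reverse_segment f hf hinj h hc hi1.symm hi2.symm
      fun j hj _ h => hadj j hj h
  · exact HasHamPath.of_reverse_segment f hf hinj h (by omega) hi1 hi2
      fun j hj h _ => hadj j hj h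

/-- The closure step of Bondy and Chvátal: a path visits `u` and `v` once each, so the added edge
accounts for at most one missing step. -/
lemma HasHamPath.of_sup_edge {G : SimpleGraph V} {W : Finset V} {s t u v : V}
    (hdeg : W.card + 1 ≤ G.degIn W u + G.degIn W v)
    (h : (G ⊔ edge u v).HasHamPath W s t) : G.HasHamPath W s t := by
  obtain ⟨f, hf, hinj, rfl, rfl, hadj⟩ := h
  by_cases hall : ∀ i, i + 1 < W.card → G.Adj (f i) (f (i + 1))
  · exact ⟨f, hf, hinj, rfl, rfl, hall⟩
  push Not at hall
  obtain ⟨c, hc, hnc⟩ := hall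
  have hcases : ∀ i, i + 1 < W.card →
      G.Adj (f i) (f (i + 1)) ∨ (f i = u ∧ f (i + 1) = v) ∨ (f i = v ∧ f (i + 1) = u) := by
    intro i hi
    have := hadj i hi
    rw [sup_adj, edge_adj] at this
    tauto
  refine HasHamPath.of_missing_edge f hf hinj hc (fun i hi hic => ?_) ?_
  · rcases hcases i hi with h | h | h
    · exact h
    all_goals
      exfalso
      rcases hcases c hc with h' | h' | h'
      · exact hnc h'
      · have h1 := hinj i (c + 1) (by omega) (by omega)
        have h2 := hinj (i + 1) c (by omega) (by omega)
        have h3 := hinj i c (by omega) (by omega)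
        rw [h.1, h'.2] at h1
        rw [h.2, h'.1] at h2
        rw [h.1, h'.1] at h3
        simp_all
        try omega
      · have h1 := hinj i (c + 1) (by omega) (by omega)
        have h2 := hinj (i + 1) c (by omega) (by omega)
        have h3 := hinj i c (by omega) (by omega)
        rw [h.1, h'.2] at h1
        rw [h.2, h'.1] at h2
        rw [h.1, h'.1] at h3
        simp_all
        try omega
  · rcases hcases c hc with h | ⟨h, h'⟩ | ⟨h, h'⟩
    · exact absurd h hnc
    · rwa [h, h']
    · rw [h, h']; omega

lemma HasHamPath.of_complete {G : SimpleGraph V} {W : Finset V} {s t : V} (hs : s ∈ W)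
    (ht : t ∈ W) (hst : s ≠ t) (h : ∀ u ∈ W, ∀ v ∈ W, u ≠ v → G.Adj u v) :
    G.HasHamPath W s t := by
  set l := s :: ((W.erase s).erase t).toList ++ [t] with hl
  have hts : t ∈ W.erase s := by simp [ht, hst.symm]
  have hlen : l.length = W.card := by
    have h1 := Finset.card_erase_of_mem hts
    have h2 := Finset.card_erase_of_mem hs
    have h3 := Finset.card_pos.2 ⟨t, hts⟩
    simp only [hl, List.length_append, List.length_cons, Finset.length_toList, List.length_nil]
    omega
  have hnd : l.Nodup := by
    simp only [hl, List.cons_append, List.nodup_cons, List.mem_append, Finset.mem_toList,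
      List.nodup_append, Finset.nodup_toList]
    simp [hst]
    grind
  have hmem : ∀ v ∈ l, v ∈ W := by
    intro v hv
    simp only [hl, List.mem_append, List.mem_cons, Finset.mem_toList, Finset.mem_erase] at hv
    grind
  have hf : ∀ i < W.card, l.getD i s ∈ W := by
    intro i hi
    rw [List.getD_eq_getElem _ _ (by omega)]
    exact hmem _ (List.getElem_mem _)
  have hinj : ∀ i j, i < W.card → j < W.card → l.getD i s = l.getD j s → i = j := by
    intro i j hi hj hij
    rw [List.getD_eq_getElem _ _ (by omega), List.getD_eq_getElem _ _ (by omega)] at hij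
    exact (hnd.getElem_inj_iff).1 hij
  refine ⟨fun i => l.getD i s, hf, hinj, by simp [hl], ?_, ?_⟩
  · rw [← hlen]
    simp [hl, List.getD]
  · intro i hi
    refine h _ (hf _ (by omega)) _ (hf _ hi) fun h => ?_
    have := hinj _ _ (by omega) hi h
    omega

/-- A Hamilton-connectedness criterion for a dense set `A` to which a few further vertices with
sufficiently many neighbours in `A` are added. -/
lemma hasHamPath_of_core [Finite V] {G : SimpleGraph V} {W A : Finset V} {s t : V} (hA : A ⊆ W)
    (hs : s ∈ W) (ht : t ∈ W) (hst : s ≠ t)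
    (h1 : ∀ u ∈ A, ∀ v ∈ A, W.card + 1 ≤ G.degIn W u + G.degIn W v)
    (h2 : ∀ x ∈ W, x ∉ A → (W \ A).card + 2 ≤ G.degIn A x)
    (h3 : (W \ A).card + 1 ≤ A.card) : G.HasHamPath W s t := by
  by_contra hG
  -- An edge-maximal graph without the path is closed under `HasHamPath.of_sup_edge`. It is shown to
  -- be complete on `W`: first within `A`, then between `A` and the other vertices, then among the
  -- latter.
  obtain ⟨M, hGM, hM⟩ := (Set.toFinite {G' : SimpleGraph V | ¬ G'.HasHamPath W s t}).exists_le_maximal hG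
  have key : ∀ u ∈ W, ∀ v ∈ W, u ≠ v → W.card + 1 ≤ M.degIn W u + M.degIn W v → M.Adj u v := by
    intro u hu v hv huv hdeg
    by_contra hnot
    have hlt : M < M ⊔ edge u v := lt_sup_edge M u v huv hnot
    refine hM.prop (HasHamPath.of_sup_edge hdeg ?_)
    by_contra hc
    exact absurd (hM.le_of_ge hc hlt.le) (not_le_of_gt hlt)
  have hWc : A.card + (W \ A).card = W.card := by
    rw [add_comm]; exact Finset.card_sdiff_add_card_eq_card hA
  have hAA : ∀ u ∈ A, ∀ v ∈ A, u ≠ v → M.Adj u v := fun u hu v hv huv =>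
    key u (hA hu) v (hA hv) huv ((h1 u hu v hv).trans
      (add_le_add (degIn_mono hGM subset_rfl) (degIn_mono hGM subset_rfl)))
  have hAx : ∀ u ∈ A, ∀ x ∈ W, x ∉ A → M.Adj x u := by
    intro u hu x hx hxA
    refine key x hx u (hA hu) (by rintro rfl; exact hxA hu) ?_
    have h4 : G.degIn A x ≤ M.degIn W x := degIn_mono hGM hA
    -- As `A` is now a clique, `u` has degree at least `A.card - 1`, and the surplus `2` in `h2`
    -- makes up the required sum `W.card + 1`.
    have h5 : A.card ≤ M.degIn W u + 1 := by
      have : A.erase u ⊆ M.nbrsIn W u := fun w hw => by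
        rw [Finset.mem_erase] at hw
        exact mem_nbrsIn.2 ⟨hA hw.2, hAA u hu w hw.2 hw.1.symm⟩
      have := Finset.card_le_card this
      rw [Finset.card_erase_of_mem hu] at this
      unfold degIn
      omega
    have := h2 x hx hxA
    omega
  have hdx : ∀ x ∈ W, x ∉ A → A.card ≤ M.degIn W x := fun x hx hxA =>
    Finset.card_le_card fun u hu => mem_nbrsIn.2 ⟨hA hu, hAx u hu x hx hxA⟩
  refine hM.prop (HasHamPath.of_complete hs ht hst fun u hu v hv huv => ?_)
  by_cases huA : u ∈ A <;> by_cases hvA : v ∈ A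
  · exact hAA u huA v hvA huv
  · exact (hAx u huA v hv hvA).symm
  · exact hAx v hvA u hu huA
  -- Both vertices are now joined to all of `A`, and `h3` says that `2 * A.card` is at least `W.card
  -- + 1`.
  · refine key u hu v hv huv ?_
    have := hdx u hu huA
    have := hdx v hv hvA
    omega

end SimpleGraph

/-! ### From Hamilton paths to a Hamiltonian cycle, and König's theorem. -/

namespace SimpleGraph

variable {V : Type*}

/-- The graph of the edges of `G` with both ends in `W`, on the vertex set of `G`. -/
def inside (G : SimpleGraph V) (W : Finset V) : SimpleGraph V where
  Adj a b := G.Adj a b ∧ a ∈ W ∧ b ∈ W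
  symm := ⟨fun _ _ h => ⟨h.1.symm, h.2.2, h.2.1⟩⟩
  loopless := ⟨fun _ h => G.loopless.irrefl _ h.1⟩

lemma inside_le (G : SimpleGraph V) (W : Finset V) : G.inside W ≤ G := fun _ _ h => h.1

lemma HasHamPath.mono {G G' : SimpleGraph V} {W : Finset V} {s t : V} (hG : G ≤ G')
    (h : G.HasHamPath W s t) : G'.HasHamPath W s t := by
  obtain ⟨f, h1, h2, h3, h4, h5⟩ := h
  exact ⟨f, h1, h2, h3, h4, fun i hi => hG (h5 i hi)⟩

lemma HasHamPath.inside {G : SimpleGraph V} {W : Finset V} {s t : V}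
    (h : G.HasHamPath W s t) : (G.inside W).HasHamPath W s t := by
  obtain ⟨f, h1, h2, h3, h4, h5⟩ := h
  exact ⟨f, h1, h2, h3, h4, fun i hi => ⟨h5 i hi, h1 i (by omega), h1 _ hi⟩⟩

lemma HasHamPath.exists_list [DecidableEq V] {G : SimpleGraph V} {W : Finset V} {s t : V}
    (hs : s ∈ W) (hst : s ≠ t) (h : G.HasHamPath W s t) :
    ∃ l : List V, (s :: (l ++ [t])).Nodup ∧ (∀ v, v ∈ s :: (l ++ [t]) ↔ v ∈ W) ∧
      (s :: (l ++ [t])).IsChain G.Adj := by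
  obtain ⟨f, hf, hinj, rfl, rfl, hadj⟩ := h
  have hpos := Finset.card_pos.2 ⟨_, hs⟩
  have h1 : W.card ≠ 1 := fun h => hst (by rw [h])
  obtain ⟨m, hm⟩ : ∃ m, W.card = m + 2 := ⟨W.card - 2, by omega⟩
  have heq : f 0 :: (((List.range m).map fun i => f (i + 1)) ++ [f (W.card - 1)]) =
      (List.range W.card).map f := by
    rw [hm, List.range_succ, List.range_succ_eq_map]
    simp [Function.comp_def]
  have himg : (Finset.range W.card).image f = W := by
    apply Finset.eq_of_subset_of_card_le
    · intro v hv
      obtain ⟨i, hi, rfl⟩ := Finset.mem_image.1 hv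
      exact hf i (Finset.mem_range.1 hi)
    · rw [Finset.card_image_of_injOn]
      · simp
      · intro i hi j hj hij
        exact hinj i j (by simpa using hi) (by simpa using hj) hij
  refine ⟨(List.range m).map fun i => f (i + 1), ?_, ?_, ?_⟩
  · rw [heq]
    refine List.Nodup.map_on ?_ List.nodup_range
    intro i hi j hj hij
    exact hinj i j (List.mem_range.1 hi) (List.mem_range.1 hj) hij
  · intro v
    rw [heq]
    conv_rhs => rw [← himg]
    simp
  · rw [heq, List.isChain_map, List.isChain_range]
    intro i hi
    exact hadj i (by omega)

variable [DecidableEq V]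

lemma exists_isHamiltonianCycle_of_list [Fintype V] {G : SimpleGraph V} {u : V} {l : List V}
    (hnd : (u :: l).Nodup) (hall : ∀ v, v ∈ u :: l) (h3 : 3 ≤ Fintype.card V)
    (hch : (u :: (l ++ [u])).IsChain G.Adj) :
    ∃ (a : V) (c : G.Walk a a), c.IsHamiltonianCycle := by
  have hch' := hch
  rw [← List.cons_append, List.isChain_append] at hch'
  obtain ⟨hc1, -, hc2⟩ := hch'
  have hlen : (u :: l).length = Fintype.card V := by
    rw [← List.toFinset_card_of_nodup hnd, ← Finset.card_univ]
    congr 1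
    ext v
    simpa using hall v
  set p := Walk.ofSupport (u :: l) (l.cons_ne_nil u) hc1 with hp
  have hpath : p.IsPath := by
    rw [Walk.isPath_def, hp, Walk.support_ofSupport]
    exact hnd
  have hplen : p.length = Fintype.card V - 1 := by
    rw [hp, Walk.length_ofSupport, hlen]
  have hadj : G.Adj ((u :: l).getLast (l.cons_ne_nil u)) ((u :: l).head (l.cons_ne_nil u)) := by
    refine hc2 _ ?_ _ (by simp)
    rw [List.getLast?_eq_getLast_of_ne_nil (l.cons_ne_nil u)]
    simp
  refine ⟨_, Walk.cons hadj p, Walk.isHamiltonianCycle_iff_isCycle_and_length_eq.2 ⟨?_, ?_⟩⟩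
  · rw [Walk.cons_isCycle_iff]
    refine ⟨hpath, fun hmem => ?_⟩
    have := hpath.length_eq_one_of_mem_edges (Sym2.eq_swap ▸ hmem)
    omega
  · rw [Walk.length_cons, hplen]
    omega

/-- Two Hamilton paths of the parts `L` and `R` and two connecting paths `w, c₁, u'` and
`w', c₂, u` through the other vertices form a Hamiltonian cycle. -/
lemma exists_isHamiltonianCycle_of_hamPaths [Fintype V] {G : SimpleGraph V} {L R : Finset V}
    {u w u' w' : V} {c₁ c₂ : List V} (hLR : Disjoint L R)
    (hc : (c₁ ++ c₂).Nodup) (hmem : ∀ v, v ∈ c₁ ++ c₂ ↔ v ∉ L ∧ v ∉ R)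
    (hu : u ∈ L) (huw : u ≠ w) (hu' : u' ∈ R) (huw' : u' ≠ w')
    (hL : G.HasHamPath L u w) (hR : G.HasHamPath R u' w')
    (h1 : (w :: (c₁ ++ [u'])).IsChain G.Adj) (h2 : (w' :: (c₂ ++ [u])).IsChain G.Adj) :
    ∃ (a : V) (c : G.Walk a a), c.IsHamiltonianCycle := by
  obtain ⟨l, hl1, hl2, hl3⟩ := hL.exists_list hu huw
  obtain ⟨r, hr1, hr2, hr3⟩ := hR.exists_list hu' huw'
  have key : ((u :: (l ++ [w])) ++ (c₁ ++ ((u' :: (r ++ [w'])) ++ c₂))).Nodup := by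
    rw [Finset.disjoint_left] at hLR
    simp only [List.nodup_append] at hc hl1 hr1 ⊢
    refine ⟨hl1, ⟨hc.1, ⟨hr1, hc.2.1, ?_⟩, ?_⟩, ?_⟩
    · rintro a ha b hb rfl
      exact ((hmem a).1 (List.mem_append_right _ hb)).2 ((hr2 a).1 ha)
    · rintro a ha b hb rfl
      rcases List.mem_append.1 hb with hb | hb
      · exact ((hmem a).1 (List.mem_append_left _ ha)).2 ((hr2 a).1 hb)
      · exact hc.2.2 a ha a hb rfl
    · rintro a ha b hb rfl
      have haL := (hl2 a).1 ha
      rcases List.mem_append.1 hb with hb | hb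
      · exact ((hmem a).1 (List.mem_append_left _ hb)).1 haL
      · rcases List.mem_append.1 hb with hb | hb
        · exact hLR haL ((hr2 a).1 hb)
        · exact ((hmem a).1 (List.mem_append_right _ hb)).1 haL
  have hall : ∀ v, v ∈ (u :: (l ++ [w])) ++ (c₁ ++ ((u' :: (r ++ [w'])) ++ c₂)) := by
    intro v
    have hm := hmem v
    rw [List.mem_append] at hm
    rw [List.mem_append, List.mem_append, List.mem_append, hl2, hr2]
    tauto
  have hcard : 3 ≤ Fintype.card V := by
    have h := List.toFinset_card_of_nodup key
    have h' := Finset.card_le_univ ((u :: (l ++ [w])) ++ (c₁ ++ ((u' :: (r ++ [w'])) ++ c₂))).toFinset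
    simp only [List.length_append, List.length_cons, List.length_nil] at h
    omega
  rw [List.cons_append] at key hall
  refine exists_isHamiltonianCycle_of_list key hall hcard ?_
  have e1 : u :: (l ++ [w] ++ (c₁ ++ (u' :: (r ++ [w']) ++ c₂)) ++ [u]) =
      (u :: l) ++ w :: (c₁ ++ (u' :: (r ++ [w']) ++ c₂) ++ [u]) := by simp
  have e2 : w :: (c₁ ++ (u' :: (r ++ [w']) ++ c₂) ++ [u]) =
      (w :: c₁) ++ u' :: (r ++ [w'] ++ c₂ ++ [u]) := by simp
  have e3 : u' :: (r ++ [w'] ++ c₂ ++ [u]) = (u' :: r) ++ w' :: (c₂ ++ [u]) := by simp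
  rw [e1, List.isChain_split]
  refine ⟨by simpa using hl3, ?_⟩
  rw [e2, List.isChain_split]
  refine ⟨by simpa using h1, ?_⟩
  rw [e3, List.isChain_split]
  exact ⟨by simpa using hr3, h2⟩

lemma degIn_fromEdgeSet_le_two {G : SimpleGraph V} {a : V} {c : G.Walk a a}
    (hc : c.IsHamiltonianCycle) (W : Finset V) (v : V) :
    (fromEdgeSet c.edgeSet).degIn W v ≤ 2 := by
  have h := hc.isCycle.ncard_neighborSet_toSubgraph_eq_two (hc.mem_support v)
  rw [← h, degIn, ← Set.ncard_coe_finset]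
  refine Set.ncard_le_ncard ?_ (Set.finite_of_ncard_ne_zero (by omega))
  intro w hw
  rw [Finset.mem_coe, mem_nbrsIn, fromEdgeSet_adj] at hw
  rw [Subgraph.mem_neighborSet, ← Subgraph.mem_edgeSet, Walk.mem_edges_toSubgraph]
  exact hw.2.1

/-- König's theorem, in the form needed here. -/
lemma exists_matching_of_le_cover {G : SimpleGraph V} {L R : Finset V} {r : ℕ}
    (h : ∀ C : Finset V, (∀ a ∈ L, ∀ b ∈ R, G.Adj a b → a ∈ C ∨ b ∈ C) → r ≤ C.card) :
    ∃ (M : Finset V) (f : V → V), M ⊆ L ∧ M.card = r ∧ Set.InjOn f M ∧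
      ∀ a ∈ M, f a ∈ R ∧ G.Adj a (f a) := by
  classical
  have hr : r ≤ L.card := h L fun a ha _ _ _ => Or.inl ha
  -- Defect form of Hall's theorem: `L.card - r` dummy partners are made available to every vertex
  -- of `L`, so a matching of all of `L` uses at least `r` true edges.
  let t : L → Finset (V ⊕ Fin (L.card - r)) := fun a => (G.nbrsIn R a).disjSum Finset.univ
  obtain ⟨g, hg, hgt⟩ := (Finset.all_card_le_biUnion_card_iff_exists_injective t).1 (by
    intro s
    rcases s.eq_empty_or_nonempty with rfl | hs
    · simp
    have hsub : (s.biUnion fun a => G.nbrsIn R a).disjSum Finset.univ ⊆ s.biUnion t := by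
      intro x hx
      obtain ⟨a, ha⟩ := hs
      rcases x with x | x
      · rw [Finset.inl_mem_disjSum, Finset.mem_biUnion] at hx
        obtain ⟨b, hb, hb'⟩ := hx
        simp only [Finset.mem_biUnion, t, Finset.inl_mem_disjSum]
        exact ⟨b, hb, hb'⟩
      · simp only [Finset.mem_biUnion, t, Finset.inr_mem_disjSum]
        exact ⟨a, ha, Finset.mem_univ _⟩
    have h1 := Finset.card_le_card hsub
    rw [Finset.card_disjSum, Finset.card_univ, Fintype.card_fin] at h1
    -- The part of `L` outside `s` together with the neighbours of `s` is a cover; its size bound is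
    -- Hall's condition for `s`.
    have h2 := h ((L \ s.map (Function.Embedding.subtype _)) ∪
      s.biUnion fun a => G.nbrsIn R a) (by
        intro a ha b hb hab
        by_cases has : (⟨a, ha⟩ : L) ∈ s
        · right
          refine Finset.mem_union_right _ (Finset.mem_biUnion.2 ⟨_, has, ?_⟩)
          simp [hb, hab]
        · left
          refine Finset.mem_union_left _ ?_
          simp [ha, has])
    have h3 := Finset.card_union_le (L \ s.map (Function.Embedding.subtype _))
      (s.biUnion fun a => G.nbrsIn R a)
    have h4 : (L \ s.map (Function.Embedding.subtype _)).card = L.card - s.card := by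
      rw [Finset.card_sdiff_of_subset, Finset.card_map]
      intro x hx
      simp only [Finset.mem_map, Function.Embedding.subtype_apply] at hx
      obtain ⟨y, -, rfl⟩ := hx
      exact y.2
    have h5 : s.card ≤ L.card := by simpa using Finset.card_le_univ s
    omega)
  set P : Finset L := Finset.univ.filter fun a => (g a).isLeft with hP
  have hPc : r ≤ P.card := by
    have h1 : (Pᶜ).card ≤ L.card - r := by
      have : (Pᶜ).image g ⊆ (Finset.univ : Finset (Fin (L.card - r))).map .inr := by
        intro x hx
        obtain ⟨a, ha, rfl⟩ := Finset.mem_image.1 hx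
        simp only [hP, Finset.mem_compl, Finset.mem_filter, Finset.mem_univ, true_and] at ha
        rcases hga : g a with y | y
        · simp [hga] at ha
        · simp
      have := Finset.card_le_card this
      rw [Finset.card_image_of_injective _ hg] at this
      simpa using this
    rw [Finset.card_compl, Fintype.card_coe] at h1
    have : P.card ≤ L.card := by simpa using Finset.card_le_univ P
    omega
  have hPm : r ≤ (P.map (Function.Embedding.subtype _)).card := by rwa [Finset.card_map]
  obtain ⟨M, hM, hMr⟩ := Finset.exists_subset_card_eq hPm
  let f : V → V := fun a => if ha : a ∈ L then (g ⟨a, ha⟩).elim id (fun _ => a) else a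
  have hf : ∀ a ∈ M, ∃ ha : a ∈ L, g ⟨a, ha⟩ = Sum.inl (f a) := by
    intro a ha
    have := hM ha
    simp only [Finset.mem_map, Function.Embedding.subtype_apply, hP, Finset.mem_filter,
      Finset.mem_univ, true_and] at this
    obtain ⟨⟨b, hb⟩, hb', rfl⟩ := this
    refine ⟨hb, ?_⟩
    rcases hga : g ⟨b, hb⟩ with y | y
    · simp [f, hb, hga]
    · simp [hga] at hb'
  refine ⟨M, f, fun a ha => (hf a ha).1, hMr, ?_, ?_⟩
  · intro a ha b hb hab
    obtain ⟨haL, ha'⟩ := hf a ha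
    obtain ⟨hbL, hb'⟩ := hf b hb
    rw [hab, ← hb'] at ha'
    simpa using hg ha'
  · intro a ha
    obtain ⟨haL, ha'⟩ := hf a ha
    have := hgt ⟨a, haL⟩
    rw [ha'] at this
    simpa [t] using this

end SimpleGraph

/-! ### The cluster structure, and the extension of a family of edge-disjoint cycles by one. -/

namespace SimpleGraph

variable {V : Type*}

/-- The vertices of `L` with a neighbour in `R`. -/
noncomputable def touched (G : SimpleGraph V) (L R : Finset V) : Finset V := by
  classical exact L.filter fun a => ∃ b ∈ R, G.Adj a b

@[simp]
lemma mem_touched {G : SimpleGraph V} {L R : Finset V} {a : V} :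
    a ∈ G.touched L R ↔ a ∈ L ∧ ∃ b ∈ R, G.Adj a b := by
  simp [touched]

lemma card_touched_sup_le [DecidableEq V] {G G' : SimpleGraph V} {L R : Finset V} :
    ((G ⊔ G').touched L R).card ≤ (G.touched L R).card + (G'.touched L R).card := by
  refine le_trans (Finset.card_le_card fun w hw => ?_) (Finset.card_union_le _ _)
  simp only [mem_touched, Finset.mem_union, sup_adj] at hw ⊢
  obtain ⟨h, b, hb, hab⟩ := hw
  rcases hab with hab | hab
  · exact Or.inl ⟨h, b, hb, hab⟩
  · exact Or.inr ⟨h, b, hb, hab⟩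

variable [Fintype V]

/-- `A` and `B` are dense clusters separated by the small set `S`, up to few edges at each vertex.
The set `S` consists of the vertices `SA` and `SB` attached to one of the clusters, and the
vertices `X` that have many neighbours in both. -/
structure Layout (G : SimpleGraph V) (k p q : ℕ) (A B SA SB X : Finset V) : Prop where
  two_le : 2 ≤ k
  one_le_p : 1 ≤ p
  one_le_q : 1 ≤ q
  large : 6 * k + 6 * p + 8 * q ≤ Fintype.card V + 10
  deg : ∀ v, Fintype.card V ≤ 2 * G.degIn Finset.univ v
  mem : ∀ v, v ∈ A ∨ v ∈ B ∨ v ∈ SA ∨ v ∈ SB ∨ v ∈ X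
  disjAB : Disjoint A B
  disjASA : Disjoint A SA
  disjASB : Disjoint A SB
  disjAX : Disjoint A X
  disjBSA : Disjoint B SA
  disjBSB : Disjoint B SB
  disjBX : Disjoint B X
  disjSASB : Disjoint SA SB
  disjSAX : Disjoint SA X
  disjSBX : Disjoint SB X
  card_lt : SA.card + SB.card + X.card < k
  nonemptyA : A.Nonempty
  nonemptyB : B.Nonempty
  crossA : ∀ v ∈ A, G.degIn B v ≤ p
  crossB : ∀ v ∈ B, G.degIn A v ≤ p
  degSA : ∀ x ∈ SA, k + 2 * q ≤ G.degIn A x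
  degSB : ∀ x ∈ SB, k + 2 * q ≤ G.degIn B x
  degXA : ∀ x ∈ X, k + q ≤ G.degIn A x
  degXB : ∀ x ∈ X, k + q ≤ G.degIn B x

namespace Layout

variable {G : SimpleGraph V} {k p q : ℕ} {A B SA SB X : Finset V}

lemma symm (h : Layout G k p q A B SA SB X) : Layout G k p q B A SB SA X where
  two_le := h.two_le
  one_le_p := h.one_le_p
  one_le_q := h.one_le_q
  large := h.large
  deg := h.deg
  mem v := by have := h.mem v; tauto
  disjAB := h.disjAB.symm
  disjASA := h.disjBSB
  disjASB := h.disjBSA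
  disjAX := h.disjBX
  disjBSA := h.disjASB
  disjBSB := h.disjASA
  disjBX := h.disjAX
  disjSASB := h.disjSASB.symm
  disjSAX := h.disjSBX
  disjSBX := h.disjSAX
  card_lt := by have := h.card_lt; omega
  nonemptyA := h.nonemptyB
  nonemptyB := h.nonemptyA
  crossA := h.crossB
  crossB := h.crossA
  degSA := h.degSB
  degSB := h.degSA
  degXA := h.degXB
  degXB := h.degXA

variable [DecidableEq V]

lemma disjoint_left (h : Layout G k p q A B SA SB X) : Disjoint (A ∪ SA) (B ∪ SB) := by
  simp only [Finset.disjoint_union_left, Finset.disjoint_union_right]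
  exact ⟨⟨h.disjAB, h.disjBSA.symm⟩, h.disjASB, h.disjSASB⟩

lemma mem_X_iff (h : Layout G k p q A B SA SB X) (v : V) :
    v ∈ X ↔ v ∉ A ∪ SA ∧ v ∉ B ∪ SB := by
  simp only [Finset.mem_union, not_or]
  have h0 := h.mem v
  have h1 : v ∈ A → v ∉ X := fun hv => Finset.disjoint_left.1 h.disjAX hv
  have h2 : v ∈ B → v ∉ X := fun hv => Finset.disjoint_left.1 h.disjBX hv
  have h3 : v ∈ SA → v ∉ X := fun hv => Finset.disjoint_left.1 h.disjSAX hv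
  have h4 : v ∈ SB → v ∉ X := fun hv => Finset.disjoint_left.1 h.disjSBX hv
  tauto

lemma degIn_univ_le (h : Layout G k p q A B SA SB X) (v : V) :
    G.degIn Finset.univ v ≤ G.degIn A v + G.degIn SA v + G.degIn B v + SB.card + X.card := by
  have h1 : (Finset.univ : Finset V) = (A ∪ SA) ∪ (B ∪ (SB ∪ X)) := by
    ext v
    have := h.mem v
    simp only [Finset.mem_union, Finset.mem_univ, true_iff]
    tauto
  rw [h1]
  have h2 := degIn_union_le (G := G) (W := A ∪ SA) (W' := B ∪ (SB ∪ X)) (v := v)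
  have h3 := degIn_union_le (G := G) (W := A) (W' := SA) (v := v)
  have h4 := degIn_union_le (G := G) (W := B) (W' := SB ∪ X) (v := v)
  have h5 := degIn_le_card (G := G) (W := SB ∪ X) (v := v)
  have h6 := Finset.card_union_le SB X
  omega

lemma card_eq (h : Layout G k p q A B SA SB X) :
    A.card + B.card + SA.card + SB.card + X.card = Fintype.card V := by
  have h1 : (Finset.univ : Finset V) = (A ∪ SA) ∪ (B ∪ SB) ∪ X := by
    ext v
    have := h.mem v
    simp only [Finset.mem_union, Finset.mem_univ, true_iff]
    tauto
  rw [← Finset.card_univ, h1, Finset.card_union_of_disjoint, Finset.card_union_of_disjoint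
    h.disjoint_left, Finset.card_union_of_disjoint h.disjASA,
    Finset.card_union_of_disjoint h.disjBSB]
  · omega
  · simp only [Finset.disjoint_union_left]
    exact ⟨⟨h.disjAX, h.disjSAX⟩, h.disjBX, h.disjSBX⟩

/-- A vertex of `A` has degree at least `n / 2`, yet at most `p` neighbours in `B`; all others lie
in `A` or in the separator. -/
lemma le_card (h : Layout G k p q A B SA SB X) :
    Fintype.card V + 2 ≤ 2 * (A.card + SA.card + SB.card + X.card + p) := by
  obtain ⟨v, hv⟩ := h.nonemptyA
  have h1 := h.degIn_univ_le v
  have h2 := h.crossA v hv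
  have h3 := degIn_add_one_le_card (G := G) hv
  have h4 := degIn_le_card (G := G) (W := SA) (v := v)
  have h5 := h.deg v
  omega

lemma card_le (h : Layout G k p q A B SA SB X) : 2 * A.card + 2 ≤ Fintype.card V + 2 * p := by
  have h1 := h.symm.le_card
  have h2 := h.card_eq
  omega

lemma card_lower (h : Layout G k p q A B SA SB X) :
    2 * k + 2 * p + 4 * q ≤ A.card + 3 := by
  have h1 := h.le_card
  have h2 := h.large
  have h3 := h.card_lt
  omega

end Layout

variable [DecidableEq V]

/-- The edges `D` used up by `j` Hamiltonian cycles; the edges of `Z` are reserved. -/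
structure Used (G : SimpleGraph V) (A B SA SB X : Finset V) (Z D : SimpleGraph V) (j : ℕ) :
    Prop where
  le : D ≤ G
  deg : ∀ v, D.degIn Finset.univ v ≤ 2 * j
  degXA : ∀ x ∈ X, D.degIn A x ≤ j
  degXB : ∀ x ∈ X, D.degIn B x ≤ j
  reserved : ∀ a b, Z.Adj a b → ¬ D.Adj a b
  touchedL : (D.touched (A ∪ SA) (B ∪ SB)).card ≤ 2 * j
  touchedR : (D.touched (B ∪ SB) (A ∪ SA)).card ≤ 2 * j

lemma Used.symm {G : SimpleGraph V} {A B SA SB X : Finset V} {Z D : SimpleGraph V} {j : ℕ}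
    (h : Used G A B SA SB X Z D j) : Used G B A SB SA X Z D j :=
  ⟨h.le, h.deg, h.degXB, h.degXA, h.reserved, h.touchedR, h.touchedL⟩

/-- Edges connecting the two clusters, which complete Hamilton paths of the clusters
to a Hamiltonian cycle. -/
structure Connector (G : SimpleGraph V) (A B SA SB X : Finset V) (Z D K : SimpleGraph V)
    (u w u' w' : V) (c₁ c₂ : List V) : Prop where
  le : K ≤ G \ D
  mem_u : u ∈ A ∪ SA
  mem_w : w ∈ A ∪ SA
  mem_u' : u' ∈ B ∪ SB
  mem_w' : w' ∈ B ∪ SB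
  ne : u ≠ w
  ne' : u' ≠ w'
  nodup : (c₁ ++ c₂).Nodup
  mem : ∀ v, v ∈ c₁ ++ c₂ ↔ v ∈ X
  chain₁ : (w :: (c₁ ++ [u'])).IsChain K.Adj
  chain₂ : (w' :: (c₂ ++ [u])).IsChain K.Adj
  degXA : ∀ x ∈ X, K.degIn A x ≤ 1
  degXB : ∀ x ∈ X, K.degIn B x ≤ 1
  reserved : ∀ a b, Z.Adj a b → ¬ K.Adj a b
  touchedL : (K.touched (A ∪ SA) (B ∪ SB)).card ≤ 2
  touchedR : (K.touched (B ∪ SB) (A ∪ SA)).card ≤ 2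

section

variable {G : SimpleGraph V} {k p q : ℕ} {A B SA SB X : Finset V} {Z D : SimpleGraph V} {j : ℕ}

lemma Used.degIn_le (hD : Used G A B SA SB X Z D j) (W : Finset V) (v : V) :
    D.degIn W v ≤ 2 * j :=
  (degIn_mono le_rfl (Finset.subset_univ W)).trans (hD.deg v)

/-- The core is `A`: its vertices lose only `p` edges to `B`, those to `SB` and `X`, and `2j` used
ones, so the closure makes it a clique. Vertices of `SA` keep at least `k + 2q - 2j` neighbours in
`A`, enough to be joined to it. -/
lemma Layout.hasHamPath (h : Layout G k p q A B SA SB X) (hD : Used G A B SA SB X Z D j)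
    (hj : j < q) {u w : V} (hu : u ∈ A ∪ SA) (hw : w ∈ A ∪ SA) (huw : u ≠ w) :
    (G \ D).HasHamPath (A ∪ SA) u w := by
  have hWA : (A ∪ SA) \ A = SA := by
    rw [Finset.union_sdiff_left, Finset.sdiff_eq_self_of_disjoint h.disjASA.symm]
  have hW : (A ∪ SA).card = A.card + SA.card := Finset.card_union_of_disjoint h.disjASA
  have h1 := h.le_card
  have h2 := h.card_le
  have h3 := h.large
  have h4 := h.card_lt
  have h5 := h.card_lower
  refine hasHamPath_of_core Finset.subset_union_left hu hw huw ?_ ?_ ?_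
  · have key : ∀ v ∈ A, Fintype.card V ≤
        2 * ((G \ D).degIn (A ∪ SA) v + 2 * j + p + SB.card + X.card) := by
      intro v hv
      have e1 := h.degIn_univ_le v
      have e2 := h.crossA v hv
      have e3 := h.deg v
      have e4 := degIn_le_sdiff_add (G := G) (D := D) (W := A ∪ SA) (v := v)
      have e5 := hD.degIn_le (A ∪ SA) v
      have e6 := degIn_union_of_disjoint (G := G) (v := v) h.disjASA
      omega
    intro v hv v' hv'
    have := key v hv
    have := key v' hv'
    omega
  · intro x hx hxA
    have hxS : x ∈ SA := by
      rw [← hWA]; exact Finset.mem_sdiff.2 ⟨hx, hxA⟩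
    have e1 := h.degSA x hxS
    have e2 := degIn_le_sdiff_add (G := G) (D := D) (W := A) (v := x)
    have e3 := hD.degIn_le A x
    rw [hWA]
    omega
  · rw [hWA]
    omega

/-- The cycle lives in the used-edge-free insides of the two sides plus `K`. All its edges between
the sides or at `X` therefore belong to `K`, and the bounds on `K` carry the bounds in `Used` from
`j` to `j + 1`. -/
lemma Layout.exists_isHamiltonianCycle (h : Layout G k p q A B SA SB X)
    (hD : Used G A B SA SB X Z D j) (hj : j < q)
    (hZ : ∀ a b, Z.Adj a b → (a ∈ A ∪ SA ∧ b ∈ B ∪ SB) ∨ (b ∈ A ∪ SA ∧ a ∈ B ∪ SB))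
    {K : SimpleGraph V} {u w u' w' : V} {c₁ c₂ : List V}
    (hK : Connector G A B SA SB X Z D K u w u' w' c₁ c₂) :
    ∃ (a : V) (c : G.Walk a a), c.IsHamiltonianCycle ∧ Disjoint D.edgeSet c.edgeSet ∧
      Used G A B SA SB X Z (D ⊔ fromEdgeSet c.edgeSet) (j + 1) := by
  set Γ : SimpleGraph V := (G \ D).inside (A ∪ SA) ⊔ (G \ D).inside (B ∪ SB) ⊔ K with hΓ
  have hdisj := Finset.disjoint_left.1 h.disjoint_left
  obtain ⟨a, c, hc⟩ := exists_isHamiltonianCycle_of_hamPaths (G := Γ) h.disjoint_left hK.nodup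
    (fun v => (hK.mem v).trans (h.mem_X_iff v)) hK.mem_u hK.ne hK.mem_u' hK.ne'
    ((h.hasHamPath hD hj hK.mem_u hK.mem_w hK.ne).inside.mono
      (le_sup_left.trans le_sup_left))
    ((h.symm.hasHamPath hD.symm hj hK.mem_u' hK.mem_w' hK.ne').inside.mono
      (le_sup_right.trans le_sup_left))
    (hK.chain₁.imp fun _ _ h => Or.inr h) (hK.chain₂.imp fun _ _ h => Or.inr h)
  have hle : Γ ≤ G \ D := sup_le (sup_le (inside_le _ _) (inside_le _ _)) hK.le
  have hleG : Γ ≤ G := hle.trans sdiff_le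
  have hc' : (c.mapLe hleG).IsHamiltonianCycle := hc.map Function.bijective_id
  have hCΓ : fromEdgeSet (c.mapLe hleG).edgeSet ≤ Γ := by
    intro x y hxy
    rw [fromEdgeSet_adj] at hxy
    have := hxy.1
    rw [Walk.mem_edgeSet, Walk.edges_mapLe_eq_edges] at this
    exact c.adj_of_mem_edges this
  have hcross : ∀ x ∈ A ∪ SA, ∀ y ∈ B ∪ SB, Γ.Adj x y → K.Adj x y := by
    rintro x hx y hy ((hxy | hxy) | hxy)
    · exact absurd hy (hdisj hxy.2.2)
    · exact absurd hxy.2.1 (hdisj hx)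
    · exact hxy
  have hXK : ∀ x ∈ X, ∀ y, Γ.Adj x y → K.Adj x y := by
    rintro x hx y ((hxy | hxy) | hxy)
    · exact absurd hxy.2.1 ((h.mem_X_iff x).1 hx).1
    · exact absurd hxy.2.1 ((h.mem_X_iff x).1 hx).2
    · exact hxy
  set C := fromEdgeSet (c.mapLe hleG).edgeSet with hC
  suffices hU : Used G A B SA SB X Z (D ⊔ C) (j + 1) by
    refine ⟨a, c.mapLe hleG, hc', ?_, hU⟩
    · rw [Set.disjoint_left]
      intro e he he'
      induction e using Sym2.ind with
      | _ x y =>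
        rw [mem_edgeSet] at he
        have : C.Adj x y := by
          rw [hC, fromEdgeSet_adj]
          exact ⟨he', he.ne⟩
        exact (hle (hCΓ this)).2 he
  refine ⟨?_, ?_, ?_, ?_, ?_, ?_, ?_⟩
  · exact sup_le hD.le (hCΓ.trans hleG)
  · intro v
    have e1 := degIn_sup_le (G := D) (G' := C) (W := Finset.univ) (v := v)
    have e2 := hD.deg v
    have e3 : C.degIn Finset.univ v ≤ 2 := degIn_fromEdgeSet_le_two hc' Finset.univ v
    omega
  · intro x hx
    have e1 := degIn_sup_le (G := D) (G' := C) (W := A) (v := x)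
    have e2 := hD.degXA x hx
    have e3 : C.degIn A x ≤ K.degIn A x := Finset.card_le_card fun y hy => by
      rw [mem_nbrsIn] at hy ⊢
      exact ⟨hy.1, hXK x hx y (hCΓ hy.2)⟩
    have e4 := hK.degXA x hx
    omega
  · intro x hx
    have e1 := degIn_sup_le (G := D) (G' := C) (W := B) (v := x)
    have e2 := hD.degXB x hx
    have e3 : C.degIn B x ≤ K.degIn B x := Finset.card_le_card fun y hy => by
      rw [mem_nbrsIn] at hy ⊢
      exact ⟨hy.1, hXK x hx y (hCΓ hy.2)⟩
    have e4 := hK.degXB x hx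
    omega
  · rintro x y hxy (hD' | hC')
    · exact hD.reserved x y hxy hD'
    · rcases hZ x y hxy with ⟨hx, hy⟩ | ⟨hy, hx⟩
      · exact hK.reserved x y hxy (hcross x hx y hy (hCΓ hC'))
      · exact hK.reserved y x hxy.symm (hcross y hy x hx (hCΓ hC').symm)
  · have e1 := card_touched_sup_le (G := D) (G' := C) (L := A ∪ SA) (R := B ∪ SB)
    have e2 := hD.touchedL
    have e3 : (C.touched (A ∪ SA) (B ∪ SB)).card ≤ (K.touched (A ∪ SA) (B ∪ SB)).card :=
      Finset.card_le_card fun x hx => by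
        rw [mem_touched] at hx ⊢
        obtain ⟨hx, y, hy, hxy⟩ := hx
        exact ⟨hx, y, hy, hcross x hx y hy (hCΓ hxy)⟩
    have e4 := hK.touchedL
    omega
  · have e1 := card_touched_sup_le (G := D) (G' := C) (L := B ∪ SB) (R := A ∪ SA)
    have e2 := hD.touchedR
    have e3 : (C.touched (B ∪ SB) (A ∪ SA)).card ≤ (K.touched (B ∪ SB) (A ∪ SA)).card :=
      Finset.card_le_card fun x hx => by
        rw [mem_touched] at hx ⊢
        obtain ⟨hx, y, hy, hxy⟩ := hx
        exact ⟨hx, y, hy, (hcross y hy x hx (hCΓ hxy).symm).symm⟩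
    have e4 := hK.touchedR
    omega

lemma Layout.exists_family (h : Layout G k p q A B SA SB X)
    (hZ : ∀ a b, Z.Adj a b → (a ∈ A ∪ SA ∧ b ∈ B ∪ SB) ∨ (b ∈ A ∪ SA ∧ a ∈ B ∪ SB))
    (hcon : ∀ (D : SimpleGraph V) (j : ℕ), j < q → Used G A B SA SB X Z D j →
      ∃ K u w u' w' c₁ c₂, Connector G A B SA SB X Z D K u w u' w' c₁ c₂)
    (j : ℕ) (hj : j ≤ q) :
    ∃ (a : Fin j → V) (c : (i : Fin j) → G.Walk (a i) (a i)),
      (∀ i, (c i).IsHamiltonianCycle) ∧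
      (∀ i i', i ≠ i' → Disjoint (c i).edgeSet (c i').edgeSet) ∧
      Used G A B SA SB X Z (fromEdgeSet (⋃ i, (c i).edgeSet)) j := by
  induction j with
  | zero =>
    refine ⟨Fin.elim0, fun i => i.elim0, fun i => i.elim0, fun i => i.elim0, ?_⟩
    have : fromEdgeSet (⋃ i : Fin 0, ((i.elim0 : G.Walk (Fin.elim0 i : V) (Fin.elim0 i))).edgeSet)
        = (⊥ : SimpleGraph V) := by simp
    rw [this]
    refine ⟨bot_le, ?_, ?_, ?_, ?_, ?_, ?_⟩ <;> simp [degIn, nbrsIn, touched]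
  | succ j ih =>
    obtain ⟨a, c, hc, hd, hU⟩ := ih (by omega)
    obtain ⟨K, u, w, u', w', c₁, c₂, hK⟩ := hcon _ j (by omega) hU
    obtain ⟨b, d, hd1, hd2, hd3⟩ := h.exists_isHamiltonianCycle hU (by omega) hZ hK
    have hsub : ∀ i, (c i).edgeSet ⊆ (fromEdgeSet (⋃ i, (c i).edgeSet)).edgeSet := by
      intro i e he
      rw [edgeSet_fromEdgeSet]
      exact ⟨Set.mem_iUnion.2 ⟨i, he⟩, fun h => G.not_isDiag_of_mem_edgeSet
        ((c i).edges_subset_edgeSet he) h⟩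
    -- Bundling each walk with its base vertex avoids a walk type that depends on an appended family
    -- of vertices.
    let σ : Fin (j + 1) → Σ a, G.Walk a a :=
      Fin.snoc (α := fun _ => Σ a, G.Walk a a) (fun i => ⟨a i, c i⟩) ⟨b, d⟩
    have hσ1 : ∀ i : Fin j, σ i.castSucc = ⟨a i, c i⟩ := fun i => by simp [σ]
    have hσ2 : σ (Fin.last j) = ⟨b, d⟩ := by simp [σ]
    refine ⟨fun i => (σ i).1, fun i => (σ i).2, ?_, ?_, ?_⟩
    · intro i
      refine Fin.lastCases ?_ (fun i => ?_) i
      · dsimp only; rw [hσ2]; exact hd1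
      · dsimp only; rw [hσ1]; exact hc i
    · intro i i'
      refine Fin.lastCases ?_ (fun i => ?_) i <;> refine Fin.lastCases ?_ (fun i' => ?_) i'
      · intro h; exact absurd rfl h
      · intro _
        dsimp only
        rw [hσ2, hσ1]
        exact (hd2.mono_left (hsub i')).symm
      · intro _
        dsimp only
        rw [hσ2, hσ1]
        exact hd2.mono_left (hsub i)
      · intro h
        dsimp only
        rw [hσ1, hσ1]
        exact hd i i' fun h' => h (by rw [h'])
    · have : (⋃ i, (σ i).2.edgeSet) = (⋃ i, (c i).edgeSet) ∪ d.edgeSet := by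
        ext e
        simp only [Set.mem_iUnion, Set.mem_union]
        constructor
        · rintro ⟨i, hi⟩
          revert hi
          refine Fin.lastCases ?_ (fun i => ?_) i
          · rw [hσ2]; exact Or.inr
          · rw [hσ1]; exact fun h => Or.inl ⟨i, h⟩
        · rintro (⟨i, hi⟩ | he)
          · refine ⟨i.castSucc, ?_⟩
            rw [hσ1]; exact hi
          · refine ⟨Fin.last j, ?_⟩
            rw [hσ2]; exact he
      rw [this, fromEdgeSet_union]
      exact hd3

end

end SimpleGraph

/-! ### Connectivity after the used edges are removed. -/

namespace SimpleGraph

variable {V : Type*}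

lemma reachable_induce_of_reachable {G G' : SimpleGraph V} {s : Set V} {a b : V}
    (hG : ∀ x y, G'.Adj x y → G.Adj x y ∧ x ∈ s ∧ y ∈ s) (h : G'.Reachable a b) (ha : a ∈ s)
    (hb : b ∈ s) : (G.induce s).Reachable ⟨a, ha⟩ ⟨b, hb⟩ := by
  rw [reachable_iff_reflTransGen] at h
  induction h with
  | refl => exact Reachable.refl _
  | tail _ hxy ih =>
    obtain ⟨h1, h2, -⟩ := hG _ _ hxy
    refine (ih h2).trans (Adj.reachable ?_)
    exact h1

lemma exists_adj_of_connected_induce {G : SimpleGraph V} {s P : Set V}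
    (h : (G.induce s).Connected) {a b : V} (ha : a ∈ s) (hb : b ∈ s) (haP : a ∈ P)
    (hbP : b ∉ P) : ∃ x ∈ s, ∃ y ∈ s, x ∈ P ∧ y ∉ P ∧ G.Adj x y := by
  by_contra hcon
  push Not at hcon
  have h1 := h.preconnected ⟨a, ha⟩ ⟨b, hb⟩
  rw [reachable_iff_reflTransGen] at h1
  have : ∀ z : s, Relation.ReflTransGen (G.induce s).Adj ⟨a, ha⟩ z → (z : V) ∈ P := by
    intro z hz
    induction hz with
    | refl => exact haP
    | tail _ hxy ih =>
      by_contra hc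
      exact hcon _ (Subtype.coe_prop _) _ (Subtype.coe_prop _) ih hc hxy
  exact hbP (this _ h1)

lemma exists_adj_of_lt_degIn {G : SimpleGraph V} {W T : Finset V} {v : V}
    (h : T.card < G.degIn W v) : ∃ w ∈ W, w ∉ T ∧ G.Adj v w := by
  obtain ⟨w, hw, hwT⟩ := Finset.exists_mem_notMem_of_card_lt_card h
  rw [mem_nbrsIn] at hw
  exact ⟨w, hw.1, hwT, hw.2⟩

variable [DecidableEq V]

lemma degIn_le_sdiff_add_card {G : SimpleGraph V} {W T : Finset V} {v : V} :
    G.degIn W v ≤ G.degIn (W \ T) v + (W ∩ T).card := by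
  have h := degIn_union_le (G := G) (W := W \ T) (W' := W ∩ T) (v := v)
  rw [Finset.sdiff_union_inter] at h
  exact h.trans (Nat.add_le_add_left degIn_le_card _)

/-- Both neighbourhoods lie in `W` without `a` and `b`, so the degree sum forces them to meet. -/
lemma exists_common_neighbor {G : SimpleGraph V} {W : Finset V} {a b : V} (ha : a ∈ W)
    (hb : b ∈ W) (hab : a ≠ b) (hadj : ¬ G.Adj a b)
    (h : W.card ≤ G.degIn W a + G.degIn W b + 1) : ∃ c ∈ W, G.Adj a c ∧ G.Adj c b := by
  have hsub : G.nbrsIn W a ∪ G.nbrsIn W b ⊆ (W.erase a).erase b := by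
    intro c hc
    simp only [Finset.mem_union, mem_nbrsIn, Finset.mem_erase] at hc ⊢
    rcases hc with ⟨hc, hac⟩ | ⟨hc, hbc⟩
    · exact ⟨fun h => hadj (h ▸ hac), hac.ne', hc⟩
    · exact ⟨hbc.ne', fun h => hadj (h ▸ hbc).symm, hc⟩
  have h1 := Finset.card_le_card hsub
  have hb' : b ∈ W.erase a := Finset.mem_erase.2 ⟨hab.symm, hb⟩
  have h2 := Finset.card_pos.2 ⟨b, hb'⟩
  rw [Finset.card_erase_of_mem hb'] at h1
  rw [Finset.card_erase_of_mem ha] at h1 h2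
  have h3 := Finset.card_union_add_card_inter (G.nbrsIn W a) (G.nbrsIn W b)
  unfold degIn at h
  obtain ⟨c, hc⟩ : (G.nbrsIn W a ∩ G.nbrsIn W b).Nonempty := by
    rw [← Finset.card_pos]; omega
  simp only [Finset.mem_inter, mem_nbrsIn] at hc
  exact ⟨c, hc.1.1, hc.1.2, hc.2.2.symm⟩

variable [Fintype V] {G : SimpleGraph V} {k p q : ℕ} {A B SA SB X : Finset V}
  {Z D : SimpleGraph V}

/-- After the deletion of the used edges and of a small set `T`, the cluster `A` remains
connected. -/
lemma Layout.reachable_of_mem (h : Layout G k p q A B SA SB X)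
    (hD : Used G A B SA SB X Z D q) {T : Finset V} (hT : T.card < k) {a b : V} (ha : a ∈ A \ T)
    (hb : b ∈ A \ T) : ((G \ D).inside (Finset.univ \ T)).Reachable a b := by
  have hin : ∀ {x y}, x ∈ A \ T → y ∈ A \ T → (G \ D).Adj x y →
      ((G \ D).inside (Finset.univ \ T)).Adj x y := fun hx hy hxy =>
    ⟨hxy, Finset.sdiff_subset_sdiff (Finset.subset_univ _) le_rfl hx,
      Finset.sdiff_subset_sdiff (Finset.subset_univ _) le_rfl hy⟩
  by_cases hab : a = b
  · rw [hab]
  by_cases hadj : (G \ D).Adj a b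
  · exact (hin ha hb hadj).reachable
  have key : ∀ v ∈ A \ T, Fintype.card V ≤ 2 * ((G \ D).degIn (A \ T) v + (A ∩ T).card + 2 * q +
      SA.card + p + SB.card + X.card) := by
    intro v hv
    have hvA := (Finset.mem_sdiff.1 hv).1
    have e1 := h.degIn_univ_le v
    have e2 := h.crossA v hvA
    have e3 := h.deg v
    have e4 := degIn_le_sdiff_add (G := G) (D := D) (W := A) (v := v)
    have e5 := hD.degIn_le A v
    have e6 := degIn_le_card (G := G) (W := SA) (v := v)
    have e7 := degIn_le_sdiff_add_card (G := G \ D) (W := A) (T := T) (v := v)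
    omega
  -- The count has no slack when `T` and the separator both have `k - 1` vertices: it then needs
  -- exactly `n ≥ 6k + 6p + 8q - 10`.
  obtain ⟨c, hc, hac, hcb⟩ := exists_common_neighbor ha hb hab hadj (by
    have e1 := key a ha
    have e2 := key b hb
    have e3 := h.card_le
    have e4 := h.large
    have e5 := h.card_lt
    have e6 := Finset.card_sdiff_add_card_inter A T
    have e7 : (A ∩ T).card ≤ T.card := Finset.card_le_card Finset.inter_subset_right
    omega)
  exact (hin ha hc hac).reachable.trans (hin hc hb hcb).reachable

lemma Layout.exists_mem_sdiff (h : Layout G k p q A B SA SB X) {T : Finset V}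
    (hT : T.card < k) : ∃ a, a ∈ A \ T := by
  obtain ⟨a, ha, haT⟩ := Finset.exists_mem_notMem_of_card_lt_card (s := T) (t := A) (by
    have := h.card_lower
    have := h.one_le_p
    have := h.one_le_q
    omega)
  exact ⟨a, Finset.mem_sdiff.2 ⟨ha, haT⟩⟩

/-- Every small set missing the crossing vertices leaves an edge between the two sides. -/
lemma Layout.exists_adj (h : Layout G k p q A B SA SB X) (hG : IsKConnected G k) {T : Finset V}
    (hT : T.card < k) (hXT : X ⊆ T) :
    ∃ y ∈ A ∪ SA, ∃ z ∈ B ∪ SB, y ∉ T ∧ z ∉ T ∧ G.Adj y z := by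
  obtain ⟨a, ha⟩ := h.exists_mem_sdiff hT
  obtain ⟨b, hb⟩ := h.symm.exists_mem_sdiff hT
  rw [Finset.mem_sdiff] at ha hb
  have hbB : b ∈ B ∪ SB := Finset.mem_union_left _ hb.1
  -- `G - T` is connected and meets both sides, so an edge leaves the first one; as `X` lies in `T`,
  -- that edge ends in the other side.
  obtain ⟨x, hx, y, hy, hxP, hyP, hxy⟩ := exists_adj_of_connected_induce (hG.2 T hT)
    (P := ((A ∪ SA : Finset V) : Set V)) ha.2 hb.2
    (Finset.mem_coe.2 (Finset.mem_union_left _ ha.1))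
    (fun hb' => Finset.disjoint_left.1 h.disjoint_left hb' hbB)
  refine ⟨x, hxP, y, ?_, hx, hy, hxy⟩
  by_contra hyR
  exact hy (hXT ((h.mem_X_iff y).2 ⟨hyP, hyR⟩))

/-- The graph remains `k`-connected if the two clusters remain linked after the deletion of any
set of fewer than `k` vertices. -/
lemma Layout.isKConnected (h : Layout G k p q A B SA SB X) (hD : Used G A B SA SB X Z D q)
    (hcross : ∀ T : Finset V, T.card < k →
      (∃ x, x ∉ T ∧ k ≤ (G \ D).degIn A x ∧ k ≤ (G \ D).degIn B x) ∨
      (∃ y ∈ A ∪ SA, ∃ z ∈ B ∪ SB, y ∉ T ∧ z ∉ T ∧ (G \ D).Adj y z)) :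
    IsKConnected (G \ D) k := by
  have hlarge := h.large
  have h2 := h.two_le
  have hp := h.one_le_p
  have hq := h.one_le_q
  refine ⟨by omega, fun T hT => ?_⟩
  obtain ⟨a, ha⟩ := h.exists_mem_sdiff hT
  obtain ⟨b, hb⟩ := h.symm.exists_mem_sdiff hT
  set Γ := (G \ D).inside (Finset.univ \ T) with hΓ
  have hadj : ∀ {x y}, x ∉ T → y ∉ T → (G \ D).Adj x y → Γ.Adj x y := fun hx hy hxy =>
    ⟨hxy, by simpa using hx, by simpa using hy⟩
  have hA : ∀ x, x ∉ T → k ≤ (G \ D).degIn A x → Γ.Reachable x a := by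
    intro x hx hxA
    obtain ⟨y, hyA, hyT, hxy⟩ := exists_adj_of_lt_degIn (hT.trans_le hxA)
    exact (hadj hx hyT hxy).reachable.trans
      (h.reachable_of_mem hD hT (Finset.mem_sdiff.2 ⟨hyA, hyT⟩) ha)
  have hB : ∀ x, x ∉ T → k ≤ (G \ D).degIn B x → Γ.Reachable x b := by
    intro x hx hxB
    obtain ⟨y, hyB, hyT, hxy⟩ := exists_adj_of_lt_degIn (hT.trans_le hxB)
    exact (hadj hx hyT hxy).reachable.trans
      (h.symm.reachable_of_mem hD.symm hT (Finset.mem_sdiff.2 ⟨hyB, hyT⟩) hb)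
  have hL : ∀ x ∈ A ∪ SA, x ∉ T → Γ.Reachable x a := by
    intro x hx hxT
    rcases Finset.mem_union.1 hx with hx | hx
    · exact h.reachable_of_mem hD hT (Finset.mem_sdiff.2 ⟨hx, hxT⟩) ha
    · refine hA x hxT ?_
      have e1 := h.degSA x hx
      have e2 := degIn_le_sdiff_add (G := G) (D := D) (W := A) (v := x)
      have e3 := hD.degIn_le A x
      omega
  have hR : ∀ x ∈ B ∪ SB, x ∉ T → Γ.Reachable x b := by
    intro x hx hxT
    rcases Finset.mem_union.1 hx with hx | hx
    · exact h.symm.reachable_of_mem hD.symm hT (Finset.mem_sdiff.2 ⟨hx, hxT⟩) hb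
    · refine hB x hxT ?_
      have e1 := h.degSB x hx
      have e2 := degIn_le_sdiff_add (G := G) (D := D) (W := B) (v := x)
      have e3 := hD.degIn_le B x
      omega
  have hab : Γ.Reachable b a := by
    rcases hcross T hT with ⟨x, hx, hxA, hxB⟩ | ⟨y, hy, z, hz, hyT, hzT, hyz⟩
    · exact (hB x hx hxB).symm.trans (hA x hx hxA)
    · exact (hR z hz hzT).symm.trans ((hadj hyT hzT hyz).symm.reachable.trans (hL y hy hyT))
  have hall : ∀ x, x ∉ T → Γ.Reachable x a := by
    intro x hx
    by_cases hxL : x ∈ A ∪ SA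
    · exact hL x hxL hx
    by_cases hxR : x ∈ B ∪ SB
    · exact (hR x hxR hx).trans hab
    have hxX := (h.mem_X_iff x).2 ⟨hxL, hxR⟩
    refine hA x hx ?_
    have e1 := h.degXA x hxX
    have e2 := degIn_le_sdiff_add (G := G) (D := D) (W := A) (v := x)
    have e3 := hD.degXA x hxX
    omega
  have : Nonempty {v : V | v ∉ T} := ⟨⟨a, (Finset.mem_sdiff.1 ha).2⟩⟩
  refine Connected.mk fun x y => ?_
  refine reachable_induce_of_reachable (G' := Γ) (fun u v huv => ?_)
    ((hall x x.2).trans (hall y y.2).symm) x.2 y.2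
  exact ⟨huv.1, by simpa using huv.2.1, by simpa using huv.2.2⟩

end SimpleGraph

/-! ### Constructing connectors. -/

namespace SimpleGraph

variable {V : Type*}

lemma degIn_le_one {G : SimpleGraph V} {W : Finset V} {v z : V}
    (h : ∀ y ∈ W, G.Adj v y → y = z) : G.degIn W v ≤ 1 := by
  rw [← Finset.card_singleton z]
  refine Finset.card_le_card fun y hy => ?_
  rw [mem_nbrsIn] at hy
  exact Finset.mem_singleton.2 (h y hy.1 hy.2)

lemma card_touched_le_two [DecidableEq V] {G : SimpleGraph V} {L R : Finset V} {z z' : V}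
    (h : ∀ y ∈ L, ∀ b ∈ R, G.Adj y b → y = z ∨ y = z') : (G.touched L R).card ≤ 2 := by
  refine le_trans (Finset.card_le_card (t := {z, z'}) fun y hy => ?_) Finset.card_le_two
  rw [mem_touched] at hy
  obtain ⟨hy, b, hb, hyb⟩ := hy
  simpa using h y hy b hb hyb

variable [DecidableEq V] {G : SimpleGraph V} {k p q : ℕ} {A B SA SB X : Finset V}
  {Z D K : SimpleGraph V} {j : ℕ}

lemma Connector.symm {u w u' w' : V} {c₁ c₂ : List V}
    (h : Connector G A B SA SB X Z D K u w u' w' c₁ c₂) :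
    Connector G B A SB SA X Z D K u' w' u w c₂ c₁ where
  le := h.le
  mem_u := h.mem_u'
  mem_w := h.mem_w'
  mem_u' := h.mem_u
  mem_w' := h.mem_w
  ne := h.ne'
  ne' := h.ne
  nodup := List.nodup_append_comm.1 h.nodup
  mem v := by rw [← h.mem v, List.mem_append, List.mem_append, or_comm]
  chain₁ := h.chain₂
  chain₂ := h.chain₁
  degXA := h.degXB
  degXB := h.degXA
  reserved := h.reserved
  touchedL := h.touchedR
  touchedR := h.touchedL

variable [Fintype V]

lemma Layout.exists_adj_A (h : Layout G k p q A B SA SB X) (hD : Used G A B SA SB X Z D j)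
    (hj : j < q) {x : V} (hx : x ∈ X) (z : V) : ∃ y ∈ A, y ≠ z ∧ (G \ D).Adj x y := by
  obtain ⟨y, hy, hyz, hxy⟩ := exists_adj_of_lt_degIn (G := G \ D) (W := A) (T := {z}) (v := x) (by
    have e1 := h.degXA x hx
    have e2 := degIn_le_sdiff_add (G := G) (D := D) (W := A) (v := x)
    have e3 := hD.degXA x hx
    have e4 := h.two_le
    rw [Finset.card_singleton]
    omega)
  exact ⟨y, hy, by simpa using hyz, hxy⟩

/-- Two crossing vertices connect the two sides. -/
lemma Layout.exists_connector_of_pair {x₁ x₂ : V} (hne : x₁ ≠ x₂)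
    (h : Layout G k p q A B SA SB {x₁, x₂})
    (hZ : ∀ a b, Z.Adj a b → (a ∈ A ∪ SA ∧ b ∈ B ∪ SB) ∨ (b ∈ A ∪ SA ∧ a ∈ B ∪ SB))
    (hD : Used G A B SA SB {x₁, x₂} Z D j) (hj : j < q) :
    ∃ K u w u' w' c₁ c₂, Connector G A B SA SB {x₁, x₂} Z D K u w u' w' c₁ c₂ := by
  have hx₁ : x₁ ∈ ({x₁, x₂} : Finset V) := by simp
  have hx₂ : x₂ ∈ ({x₁, x₂} : Finset V) := by simp
  obtain ⟨w, hwA, -, hw⟩ := h.exists_adj_A hD hj hx₁ x₁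
  obtain ⟨u, huA, huw, hu⟩ := h.exists_adj_A hD hj hx₂ w
  obtain ⟨u', hu'B, -, hu'⟩ := h.symm.exists_adj_A hD.symm hj hx₁ x₁
  obtain ⟨w', hw'B, hwu', hw'⟩ := h.symm.exists_adj_A hD.symm hj hx₂ u'
  have hwL : w ∈ A ∪ SA := Finset.mem_union_left _ hwA
  have huL : u ∈ A ∪ SA := Finset.mem_union_left _ huA
  have hu'R : u' ∈ B ∪ SB := Finset.mem_union_left _ hu'B
  have hw'R : w' ∈ B ∪ SB := Finset.mem_union_left _ hw'B
  have hd := Finset.disjoint_left.1 h.disjoint_left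
  obtain ⟨h1L, h1R⟩ := (h.mem_X_iff x₁).1 hx₁
  obtain ⟨h2L, h2R⟩ := (h.mem_X_iff x₂).1 hx₂
  have hAL : ∀ y ∈ A, y ∈ A ∪ SA := fun y hy => Finset.mem_union_left _ hy
  have hBR : ∀ y ∈ B, y ∈ B ∪ SB := fun y hy => Finset.mem_union_left _ hy
  -- The sides become opaque sets, so that the closing case analyses see only membership and
  -- disjointness.
  generalize hL : A ∪ SA = L at *
  generalize hR : B ∪ SB = R at *
  have hK : ∀ a b, (fromEdgeSet {s(w, x₁), s(x₁, u'), s(w', x₂), s(x₂, u)}).Adj a b →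
      (a = w ∧ b = x₁) ∨ (a = x₁ ∧ b = w) ∨ (a = u' ∧ b = x₁) ∨ (a = x₁ ∧ b = u') ∨
      (a = u ∧ b = x₂) ∨ (a = x₂ ∧ b = u) ∨ (a = w' ∧ b = x₂) ∨ (a = x₂ ∧ b = w') := by
    intro a b hab
    simp only [fromEdgeSet_adj, Set.mem_insert_iff, Set.mem_singleton_iff, Sym2.eq_iff] at hab
    rcases hab.1 with (h | h) | (h | h) | (h | h) | (h | h) <;> obtain ⟨rfl, rfl⟩ := h <;> simp
  refine ⟨fromEdgeSet {s(w, x₁), s(x₁, u'), s(w', x₂), s(x₂, u)}, u, w, u', w', [x₁], [x₂],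
    ?_, by rwa [hL], by rwa [hL], by rwa [hR], by rwa [hR], huw, hwu'.symm, by simpa using hne,
    by simp, ?_, ?_, ?_, ?_, ?_, ?_, ?_⟩
  · intro a b hab
    rcases hK a b hab with ⟨rfl, rfl⟩ | ⟨rfl, rfl⟩ | ⟨rfl, rfl⟩ | ⟨rfl, rfl⟩ | ⟨rfl, rfl⟩ |
      ⟨rfl, rfl⟩ | ⟨rfl, rfl⟩ | ⟨rfl, rfl⟩
    exacts [hw.symm, hw, hu'.symm, hu', hu.symm, hu, hw'.symm, hw']
  · simp [hw.ne', hu'.ne]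
  · simp [hw'.ne', hu.ne]
  · intro x hx
    rcases Finset.mem_insert.1 hx with rfl | hx
    · exact degIn_le_one (z := w) fun y hy hxy => by
        have := hK _ _ hxy; have := hAL y hy; grind
    · rw [Finset.mem_singleton] at hx
      subst hx
      exact degIn_le_one (z := u) fun y hy hxy => by
        have := hK _ _ hxy; have := hAL y hy; grind
  · intro x hx
    rcases Finset.mem_insert.1 hx with rfl | hx
    · exact degIn_le_one (z := u') fun y hy hxy => by
        have := hK _ _ hxy; have := hBR y hy; grind
    · rw [Finset.mem_singleton] at hx
      subst hx
      exact degIn_le_one (z := w') fun y hy hxy => by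
        have := hK _ _ hxy; have := hBR y hy; grind
  · intro a b hab hab'
    have := hK _ _ hab'
    have := hZ a b hab
    grind
  · rw [hL, hR]
    -- All edges of this connector meet `X`, so no vertex is touched and the witness `u` is
    -- arbitrary.
    refine card_touched_le_two (z := u) (z' := u) fun y hy b hb hyb => ?_
    have := hK _ _ hyb
    grind
  · rw [hL, hR]
    refine card_touched_le_two (z := u) (z' := u) fun y hy b hb hyb => ?_
    have := hK _ _ hyb
    grind

/-- One crossing vertex and one edge connect the two sides. -/
lemma Layout.exists_connector_of_singleton {x u w' : V}
    (h : Layout G k p q A B SA SB {x})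
    (hZ : ∀ a b, Z.Adj a b → (a ∈ A ∪ SA ∧ b ∈ B ∪ SB) ∨ (b ∈ A ∪ SA ∧ a ∈ B ∪ SB))
    (hD : Used G A B SA SB {x} Z D j) (hj : j < q) (huL : u ∈ A ∪ SA) (hw'R : w' ∈ B ∪ SB)
    (huw : (G \ D).Adj u w') (huZ : ¬ Z.Adj u w') :
    ∃ K u w u' w' c₁ c₂, Connector G A B SA SB {x} Z D K u w u' w' c₁ c₂ := by
  have hx : x ∈ ({x} : Finset V) := by simp
  obtain ⟨w, hwA, hwu, hw⟩ := h.exists_adj_A hD hj hx u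
  obtain ⟨u', hu'B, hu'w', hu'⟩ := h.symm.exists_adj_A hD.symm hj hx w'
  have hwL : w ∈ A ∪ SA := Finset.mem_union_left _ hwA
  have hu'R : u' ∈ B ∪ SB := Finset.mem_union_left _ hu'B
  have hd := Finset.disjoint_left.1 h.disjoint_left
  obtain ⟨h1L, h1R⟩ := (h.mem_X_iff x).1 hx
  have hAL : ∀ y ∈ A, y ∈ A ∪ SA := fun y hy => Finset.mem_union_left _ hy
  have hBR : ∀ y ∈ B, y ∈ B ∪ SB := fun y hy => Finset.mem_union_left _ hy
  generalize hL : A ∪ SA = L at *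
  generalize hR : B ∪ SB = R at *
  have hK : ∀ a b, (fromEdgeSet {s(w, x), s(x, u'), s(w', u)}).Adj a b →
      (a = w ∧ b = x) ∨ (a = x ∧ b = w) ∨ (a = u' ∧ b = x) ∨ (a = x ∧ b = u') ∨
      (a = u ∧ b = w') ∨ (a = w' ∧ b = u) := by
    intro a b hab
    simp only [fromEdgeSet_adj, Set.mem_insert_iff, Set.mem_singleton_iff, Sym2.eq_iff] at hab
    tauto
  refine ⟨fromEdgeSet {s(w, x), s(x, u'), s(w', u)}, u, w, u', w', [x], [],
    ?_, by rwa [hL], by rwa [hL], by rwa [hR], by rwa [hR], hwu.symm, hu'w', by simp,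
    by simp, ?_, ?_, ?_, ?_, ?_, ?_, ?_⟩
  · intro a b hab
    rcases hK a b hab with ⟨rfl, rfl⟩ | ⟨rfl, rfl⟩ | ⟨rfl, rfl⟩ | ⟨rfl, rfl⟩ | ⟨rfl, rfl⟩ |
      ⟨rfl, rfl⟩
    exacts [hw.symm, hw, hu'.symm, hu', huw, huw.symm]
  · simp [hw.ne', hu'.ne]
  · simp [huw.ne']
  · intro y hy
    rw [Finset.mem_singleton] at hy
    subst hy
    exact degIn_le_one (z := w) fun y hy hxy => by
      have := hK _ _ hxy; have := hAL y hy; grind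
  · intro y hy
    rw [Finset.mem_singleton] at hy
    subst hy
    exact degIn_le_one (z := u') fun y hy hxy => by
      have := hK _ _ hxy; have := hBR y hy; grind
  · intro a b hab hab'
    have := hK _ _ hab'
    have := hZ a b hab
    have := hab.symm
    grind
  · rw [hL, hR]
    refine card_touched_le_two (z := u) (z' := u) fun y hy b hb hyb => ?_
    have := hK _ _ hyb
    grind
  · rw [hL, hR]
    refine card_touched_le_two (z := w') (z' := w') fun y hy b hb hyb => ?_
    have := hK _ _ hyb
    grind

/-- Two disjoint edges connect the two sides. -/
lemma Layout.exists_connector_of_empty {u w u' w' : V}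
    (h : Layout G k p q A B SA SB ∅) (huL : u ∈ A ∪ SA)
    (hwL : w ∈ A ∪ SA) (hu'R : u' ∈ B ∪ SB) (hw'R : w' ∈ B ∪ SB) (hne : u ≠ w) (hne' : u' ≠ w')
    (huw : (G \ D).Adj u w') (huZ : ¬ Z.Adj u w') (hwu : (G \ D).Adj w u') (hwZ : ¬ Z.Adj w u') :
    ∃ K u w u' w' c₁ c₂, Connector G A B SA SB ∅ Z D K u w u' w' c₁ c₂ := by
  have hd := Finset.disjoint_left.1 h.disjoint_left
  have hK : ∀ a b, (fromEdgeSet {s(w, u'), s(w', u)}).Adj a b →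
      (a = w ∧ b = u') ∨ (a = u' ∧ b = w) ∨ (a = u ∧ b = w') ∨ (a = w' ∧ b = u) := by
    intro a b hab
    simp only [fromEdgeSet_adj, Set.mem_insert_iff, Set.mem_singleton_iff, Sym2.eq_iff] at hab
    tauto
  refine ⟨fromEdgeSet {s(w, u'), s(w', u)}, u, w, u', w', [], [],
    ?_, huL, hwL, hu'R, hw'R, hne, hne', by simp,
    by simp, ?_, ?_, by simp, by simp, ?_, ?_, ?_⟩
  · intro a b hab
    rcases hK a b hab with ⟨rfl, rfl⟩ | ⟨rfl, rfl⟩ | ⟨rfl, rfl⟩ | ⟨rfl, rfl⟩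
    exacts [hwu, hwu.symm, huw, huw.symm]
  · simp [hwu.ne]
  · simp [huw.ne']
  · intro a b hab hab'
    have := hK _ _ hab'
    have := hab.symm
    grind
  · refine card_touched_le_two (z := u) (z' := w) fun y hy b hb hyb => ?_
    have := hd hy
    have := hK _ _ hyb
    grind
  · refine card_touched_le_two (z := u') (z' := w') fun y hy b hb hyb => ?_
    have := fun h => hd h hy
    have := hK _ _ hyb
    grind

/-- With `|X| ≤ 1`, a vertex of the smaller side has fewer than `n / 2` neighbours in that side and
`X`, so it has one across. Choosing one such edge per vertex gives far more edges than are reserved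
or used. -/
lemma Layout.exists_connector_of_card_le (h : Layout G k p q A B SA SB X) (hX : X.card ≤ 1)
    (hSB : ∀ x ∈ SB, G.degIn A x < k + q) (hcard : (A ∪ SA).card ≤ (B ∪ SB).card)
    (hZ : ∀ a b, Z.Adj a b → (a ∈ A ∪ SA ∧ b ∈ B ∪ SB) ∨ (b ∈ A ∪ SA ∧ a ∈ B ∪ SB))
    (hZc : (Z.touched (A ∪ SA) (B ∪ SB)).card ≤ k)
    (hD : Used G A B SA SB X Z D j) (hj : j < q) :
    ∃ K u w u' w' c₁ c₂, Connector G A B SA SB X Z D K u w u' w' c₁ c₂ := by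
  classical
  have hn : (A ∪ SA).card + (B ∪ SB).card + X.card = Fintype.card V := by
    rw [Finset.card_union_of_disjoint h.disjASA, Finset.card_union_of_disjoint h.disjBSB]
    have := h.card_eq
    omega
  have hex : ∀ x ∈ A ∪ SA, ∃ y ∈ B ∪ SB, G.Adj x y := by
    intro x hx
    by_contra hcon
    push Not at hcon
    have e0 : (Finset.univ : Finset V) = (A ∪ SA) ∪ (B ∪ SB) ∪ X := by
      ext v
      have := h.mem_X_iff v
      simp only [Finset.mem_union, Finset.mem_univ, true_iff] at this ⊢
      tauto
    have e1 := degIn_union_le (G := G) (W := (A ∪ SA) ∪ (B ∪ SB)) (W' := X) (v := x)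
    have e2 := degIn_union_le (G := G) (W := A ∪ SA) (W' := B ∪ SB) (v := x)
    have e3 : G.degIn (B ∪ SB) x = 0 := Finset.card_eq_zero.2 <| by
      ext y
      simp only [mem_nbrsIn, Finset.notMem_empty, iff_false, not_and]
      exact hcon y
    have e4 := degIn_add_one_le_card (G := G) hx
    have e5 := degIn_le_card (G := G) (W := X) (v := x)
    have e6 := h.deg x
    rw [e0] at e6
    omega
  choose! f hfR hf using hex
  set M := (A ∪ SA).filter fun x => ¬ Z.Adj x (f x) ∧ ¬ D.Adj x (f x) with hM
  -- A chosen edge is excluded only at a vertex touched by `Z` (at most `k`) or by `D` (at most `2 *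
  -- j`).
  have hMcard : (A ∪ SA).card ≤ M.card + k + 2 * j := by
    have hsub : A ∪ SA ⊆ M ∪ Z.touched (A ∪ SA) (B ∪ SB) ∪ D.touched (A ∪ SA) (B ∪ SB) := by
      intro x hx
      by_cases h1 : Z.Adj x (f x)
      · exact Finset.mem_union_left _ (Finset.mem_union_right _
          (mem_touched.2 ⟨hx, _, hfR x hx, h1⟩))
      by_cases h2 : D.Adj x (f x)
      · exact Finset.mem_union_right _ (mem_touched.2 ⟨hx, _, hfR x hx, h2⟩)
      · exact Finset.mem_union_left _ (Finset.mem_union_left _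
          (Finset.mem_filter.2 ⟨hx, h1, h2⟩))
    have e1 := Finset.card_le_card hsub
    have e2 := Finset.card_union_le (M ∪ Z.touched (A ∪ SA) (B ∪ SB)) (D.touched (A ∪ SA) (B ∪ SB))
    have e3 := Finset.card_union_le M (Z.touched (A ∪ SA) (B ∪ SB))
    have e4 := hD.touchedL
    omega
  have hAc : (A ∪ SA).card = A.card + SA.card := Finset.card_union_of_disjoint h.disjASA
  have hlow := h.card_lower
  have hM' : ∀ x ∈ M, x ∈ A ∪ SA ∧ f x ∈ B ∪ SB ∧ (G \ D).Adj x (f x) ∧ ¬ Z.Adj x (f x) := by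
    intro x hx
    obtain ⟨hx, h1, h2⟩ := Finset.mem_filter.1 hx
    exact ⟨hx, hfR x hx, ⟨hf x hx, h2⟩, h1⟩
  obtain ⟨x, hx⟩ : M.Nonempty := by
    rw [← Finset.card_pos]
    omega
  obtain ⟨hx1, hx2, hx3, hx4⟩ := hM' x hx
  rcases Nat.le_one_iff_eq_zero_or_eq_one.1 hX with hX0 | hX1
  · rw [Finset.card_eq_zero] at hX0
    subst hX0
    -- If all chosen edges ended in `f x`, it would have too many neighbours on the small side: at
    -- most `p` in `A` if it lies in `B`, fewer than `k + q` if in `SB`, plus those in `SA`.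
    obtain ⟨y, hy, hxy⟩ : ∃ y ∈ M, f y ≠ f x := by
      by_contra hcon
      push Not at hcon
      have e1 : M.card ≤ G.degIn (A ∪ SA) (f x) := Finset.card_le_card fun y hy => by
        rw [mem_nbrsIn, ← hcon y hy]
        exact ⟨(hM' y hy).1, (hM' y hy).2.2.1.1.symm⟩
      have e2 := degIn_union_le (G := G) (W := A) (W' := SA) (v := f x)
      have e3 := degIn_le_card (G := G) (W := SA) (v := f x)
      have e4 := h.one_le_p
      rcases Finset.mem_union.1 hx2 with hB | hB
      · have := h.crossB _ hB
        omega
      · have := hSB _ hB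
        omega
    obtain ⟨hy1, hy2, hy3, hy4⟩ := hM' y hy
    exact h.exists_connector_of_empty hx1 hy1 hy2 hx2 (fun h => hxy (by rw [h])) hxy hx3 hx4 hy3 hy4
  · obtain ⟨z, rfl⟩ := Finset.card_eq_one.1 hX1
    exact h.exists_connector_of_singleton hZ hD hj hx1 hx2 hx3 hx4

lemma Layout.exists_connector (h : Layout G k p q A B SA SB X) (hX : X.card ≤ 1)
    (hSA : ∀ x ∈ SA, G.degIn B x < k + q) (hSB : ∀ x ∈ SB, G.degIn A x < k + q)
    (hZ : ∀ a b, Z.Adj a b → (a ∈ A ∪ SA ∧ b ∈ B ∪ SB) ∨ (b ∈ A ∪ SA ∧ a ∈ B ∪ SB))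
    (hZL : (Z.touched (A ∪ SA) (B ∪ SB)).card ≤ k)
    (hZR : (Z.touched (B ∪ SB) (A ∪ SA)).card ≤ k)
    (hD : Used G A B SA SB X Z D j) (hj : j < q) :
    ∃ K u w u' w' c₁ c₂, Connector G A B SA SB X Z D K u w u' w' c₁ c₂ := by
  rcases le_total (A ∪ SA).card (B ∪ SB).card with hc | hc
  · exact h.exists_connector_of_card_le hX hSB hc hZ hZL hD hj
  · obtain ⟨K, u, w, u', w', c₁, c₂, hK⟩ := h.symm.exists_connector_of_card_le hX hSA hc
      (fun a b hab => (hZ a b hab).symm.imp And.symm And.symm) hZR hD.symm hj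
    exact ⟨K, u', w', u, w, c₂, c₁, hK.symm⟩

end SimpleGraph

/-! ### The separation, and the two cases according to the vertices rich in both clusters. -/

namespace SimpleGraph

variable {V : Type*} [Fintype V] [DecidableEq V] {G : SimpleGraph V} {k p q : ℕ}

/-- If the deletion of a subgraph of maximum degree at most `p` destroys `k`-connectedness, then
fewer than `k` vertices separate two parts between which every vertex has at most `p` edges. -/
lemma exists_separation {H : SimpleGraph V} [DecidableRel H.Adj] (hHp : H.maxDegree ≤ p)
    (hk : k < Fintype.card V) (h : ¬ IsKConnected (G \ H) k) :
    ∃ A B S : Finset V, Disjoint A B ∧ Disjoint A S ∧ Disjoint B S ∧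
      (∀ v, v ∈ A ∨ v ∈ B ∨ v ∈ S) ∧ S.card < k ∧ A.Nonempty ∧ B.Nonempty ∧
      (∀ v ∈ A, G.degIn B v ≤ p) ∧ ∀ v ∈ B, G.degIn A v ≤ p := by
  classical
  have hS : ∃ S : Finset V, S.card < k ∧ ¬ ((G \ H).induce {v : V | v ∉ S}).Connected := by
    by_contra hcon
    push Not at hcon
    exact h ⟨hk, hcon⟩
  obtain ⟨S, hSk, hS⟩ := hS
  obtain ⟨v, -, hv⟩ := Finset.exists_mem_notMem_of_card_lt_card (s := S) (t := Finset.univ)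
    (by rw [Finset.card_univ]; omega)
  have hne : Nonempty {v : V | v ∉ S} := ⟨⟨v, hv⟩⟩
  have hpre : ¬ ((G \ H).induce {v : V | v ∉ S}).Preconnected := fun h => hS ⟨h⟩
  unfold Preconnected at hpre
  push Not at hpre
  obtain ⟨a, b, hab⟩ := hpre
  -- `A` is one component of `G - H - S` and `B` is the rest, so every edge of `G` between them
  -- belongs to `H`.
  set P : V → Prop := fun v => ∃ hv : v ∉ S,
    ((G \ H).induce {v : V | v ∉ S}).Reachable a ⟨v, hv⟩ with hP
  have hdeg : ∀ (v : V) (W : Finset V), (∀ w ∈ W, G.Adj v w → H.Adj v w) → G.degIn W v ≤ p := by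
    intro v W hW
    refine le_trans (Finset.card_le_card (t := H.neighborFinset v) fun w hw => ?_)
      ((H.degree_le_maxDegree v).trans hHp)
    rw [mem_nbrsIn] at hw
    exact (H.mem_neighborFinset v w).2 (hW w hw.1 hw.2)
  have hadj : ∀ v w, P v → w ∉ S → ¬ P w → G.Adj v w → H.Adj v w := by
    rintro v w ⟨hv, hav⟩ hw hPw hvw
    by_contra hH
    refine hPw ⟨hw, hav.trans (Adj.reachable ?_)⟩
    exact ⟨hvw, hH⟩
  refine ⟨Finset.univ.filter P, Finset.univ.filter fun v => v ∉ S ∧ ¬ P v, S, ?_, ?_, ?_, ?_, hSk,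
    ?_, ?_, ?_, ?_⟩
  · rw [Finset.disjoint_left]
    intro v hv hv'
    exact (Finset.mem_filter.1 hv').2.2 (Finset.mem_filter.1 hv).2
  · rw [Finset.disjoint_left]
    intro v hv hv'
    exact (Finset.mem_filter.1 hv).2.1 hv'
  · rw [Finset.disjoint_left]
    intro v hv hv'
    exact (Finset.mem_filter.1 hv).2.1 hv'
  · intro v
    simp only [Finset.mem_filter, Finset.mem_univ, true_and]
    tauto
  · exact ⟨a, Finset.mem_filter.2 ⟨Finset.mem_univ _, a.2, Reachable.refl _⟩⟩
  · exact ⟨b, Finset.mem_filter.2 ⟨Finset.mem_univ _, b.2, fun ⟨_, h⟩ => hab h⟩⟩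
  · intro v hv
    refine hdeg v _ fun w hw hvw => ?_
    obtain ⟨-, hw1, hw2⟩ := Finset.mem_filter.1 hw
    exact hadj v w (Finset.mem_filter.1 hv).2 hw1 hw2 hvw
  · intro v hv
    refine hdeg v _ fun w hw hvw => ?_
    obtain ⟨-, hv1, hv2⟩ := Finset.mem_filter.1 hv
    exact (hadj w v (Finset.mem_filter.1 hw).2 hv1 hv2 hvw.symm).symm

/-- Vertices of `S` outside `X` join the cluster in which they have more neighbours; half of `2k +
4q` is the surplus that a layout demands. -/
lemma layout_of_separation {A B S X : Finset V} (h2 : 2 ≤ k) (hp : 1 ≤ p) (hq : 1 ≤ q)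
    (hlarge : 6 * k + 6 * p + 8 * q ≤ Fintype.card V + 10)
    (hdeg : ∀ v, Fintype.card V ≤ 2 * G.degIn Finset.univ v)
    (hAB : Disjoint A B) (hAS : Disjoint A S) (hBS : Disjoint B S)
    (hmem : ∀ v, v ∈ A ∨ v ∈ B ∨ v ∈ S) (hS : S.card < k) (hA : A.Nonempty) (hB : B.Nonempty)
    (hcA : ∀ v ∈ A, G.degIn B v ≤ p) (hcB : ∀ v ∈ B, G.degIn A v ≤ p) (hXS : X ⊆ S)
    (hX : ∀ x ∈ X, k + q ≤ G.degIn A x ∧ k + q ≤ G.degIn B x) :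
    Layout G k p q A B ((S \ X).filter fun x => G.degIn B x ≤ G.degIn A x)
      ((S \ X).filter fun x => ¬ G.degIn B x ≤ G.degIn A x) X := by
  -- At most `k - 2` of at least `n / 2` neighbours lie in `S`, and `p ≥ 1` absorbs the remaining
  -- constant.
  have hsum : ∀ x ∈ S, 2 * k + 4 * q ≤ G.degIn A x + G.degIn B x := by
    intro x hx
    have e0 : (Finset.univ : Finset V) = A ∪ B ∪ S := by
      ext v
      have := hmem v
      simp only [Finset.mem_union, Finset.mem_univ, true_iff]
      tauto
    have e1 := degIn_union_le (G := G) (W := A ∪ B) (W' := S) (v := x)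
    have e2 := degIn_union_le (G := G) (W := A) (W' := B) (v := x)
    have e3 := degIn_add_one_le_card (G := G) hx
    have e4 := hdeg x
    rw [e0] at e4
    omega
  have hsub : ∀ (P : V → Prop) [DecidablePred P], (S \ X).filter P ⊆ S := fun P _ =>
    (Finset.filter_subset _ _).trans Finset.sdiff_subset
  have hSX : ∀ (P : V → Prop) [DecidablePred P], Disjoint ((S \ X).filter P) X := fun P _ =>
    Finset.disjoint_of_subset_left (Finset.filter_subset _ _) Finset.sdiff_disjoint
  refine ⟨h2, hp, hq, hlarge, hdeg, ?_, hAB, hAS.mono_right (hsub _), hAS.mono_right (hsub _),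
    hAS.mono_right hXS, hBS.mono_right (hsub _), hBS.mono_right (hsub _), hBS.mono_right hXS,
    Finset.disjoint_filter_filter_not _ _ _, hSX _, hSX _, ?_, hA, hB, hcA, hcB, ?_, ?_,
    fun x hx => (hX x hx).1, fun x hx => (hX x hx).2⟩
  · intro v
    have := hmem v
    simp only [Finset.mem_filter, Finset.mem_sdiff]
    tauto
  · rw [Finset.card_filter_add_card_filter_not]
    have := Finset.card_sdiff_add_card_eq_card hXS
    omega
  · intro x hx
    obtain ⟨hx1, hx2⟩ := Finset.mem_filter.1 hx
    have := hsum x (Finset.mem_sdiff.1 hx1).1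
    omega
  · intro x hx
    obtain ⟨hx1, hx2⟩ := Finset.mem_filter.1 hx
    have := hsum x (Finset.mem_sdiff.1 hx1).1
    omega

variable {A B SA SB X : Finset V} {Z : SimpleGraph V}

lemma Layout.exists_hamiltonianCycles (h : Layout G k p q A B SA SB X)
    (hZ : ∀ a b, Z.Adj a b → (a ∈ A ∪ SA ∧ b ∈ B ∪ SB) ∨ (b ∈ A ∪ SA ∧ a ∈ B ∪ SB))
    (hcon : ∀ (D : SimpleGraph V) (j : ℕ), j < q → Used G A B SA SB X Z D j →
      ∃ K u w u' w' c₁ c₂, Connector G A B SA SB X Z D K u w u' w' c₁ c₂)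
    (hcross : ∀ D : SimpleGraph V, Used G A B SA SB X Z D q → ∀ T : Finset V, T.card < k →
      (∃ x, x ∉ T ∧ k ≤ (G \ D).degIn A x ∧ k ≤ (G \ D).degIn B x) ∨
      (∃ y ∈ A ∪ SA, ∃ z ∈ B ∪ SB, y ∉ T ∧ z ∉ T ∧ (G \ D).Adj y z)) :
    ∃ (a : Fin q → V) (c : (i : Fin q) → G.Walk (a i) (a i)),
      (∀ i, (c i).IsHamiltonianCycle) ∧
      (∀ i j, i ≠ j → Disjoint (c i).edgeSet (c j).edgeSet) ∧
      IsKConnected (G.deleteEdges (⋃ i, (c i).edgeSet)) k := by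
  obtain ⟨a, c, hc, hd, hU⟩ := h.exists_family hZ hcon q le_rfl
  exact ⟨a, c, hc, hd, h.isKConnected hU (hcross _ hU)⟩

lemma Layout.le_degIn_of_mem_X (h : Layout G k p q A B SA SB X) {D : SimpleGraph V}
    (hD : Used G A B SA SB X Z D q) {x : V} (hx : x ∈ X) :
    k ≤ (G \ D).degIn A x ∧ k ≤ (G \ D).degIn B x := by
  have e1 := h.degXA x hx
  have e2 := degIn_le_sdiff_add (G := G) (D := D) (W := A) (v := x)
  have e3 := hD.degXA x hx
  have e4 := h.degXB x hx
  have e5 := degIn_le_sdiff_add (G := G) (D := D) (W := B) (v := x)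
  have e6 := hD.degXB x hx
  omega

/-- The edges of `G` between `L` and `R`. -/
def crossing (G : SimpleGraph V) (L R : Finset V) : SimpleGraph V where
  Adj a b := G.Adj a b ∧ ((a ∈ L ∧ b ∈ R) ∨ (b ∈ L ∧ a ∈ R))
  symm := ⟨fun _ _ h => ⟨h.1.symm, h.2.symm⟩⟩
  loopless := ⟨fun _ h => G.loopless.irrefl _ h.1⟩

/-- Two vertices with many neighbours in both clusters suffice to link them. -/
lemma Layout.exists_hamiltonianCycles_of_pair {x₁ x₂ : V} (hne : x₁ ≠ x₂) (hG : IsKConnected G k)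
    (h : Layout G k p q A B SA SB {x₁, x₂}) :
    ∃ (a : Fin q → V) (c : (i : Fin q) → G.Walk (a i) (a i)),
      (∀ i, (c i).IsHamiltonianCycle) ∧
      (∀ i j, i ≠ j → Disjoint (c i).edgeSet (c j).edgeSet) ∧
      IsKConnected (G.deleteEdges (⋃ i, (c i).edgeSet)) k := by
  have hZ : ∀ a b, (G.crossing (A ∪ SA) (B ∪ SB)).Adj a b →
      (a ∈ A ∪ SA ∧ b ∈ B ∪ SB) ∨ (b ∈ A ∪ SA ∧ a ∈ B ∪ SB) := fun a b hab => hab.2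
  refine h.exists_hamiltonianCycles hZ
    (fun D j hj hD => h.exists_connector_of_pair hne hZ hD hj) fun D hD T hT => ?_
  by_cases hXT : ({x₁, x₂} : Finset V) ⊆ T
  · obtain ⟨y, hy, z, hz, hyT, hzT, hyz⟩ := h.exists_adj hG hT hXT
    exact Or.inr ⟨y, hy, z, hz, hyT, hzT, hyz, hD.reserved y z ⟨hyz, Or.inl ⟨hy, hz⟩⟩⟩
  · rw [Finset.not_subset] at hXT
    obtain ⟨x, hx, hxT⟩ := hXT
    exact Or.inl ⟨x, hxT, h.le_degIn_of_mem_X hD hx⟩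

/-- If at most one vertex has many neighbours in both clusters, then there are many edges between
the two sides, and a matching of them can be reserved. -/
lemma Layout.exists_hamiltonianCycles_of_card_le (h : Layout G k p q A B SA SB X)
    (hG : IsKConnected G k) (hX : X.card ≤ 1) (hSA : ∀ x ∈ SA, G.degIn B x < k + q)
    (hSB : ∀ x ∈ SB, G.degIn A x < k + q) :
    ∃ (a : Fin q → V) (c : (i : Fin q) → G.Walk (a i) (a i)),
      (∀ i, (c i).IsHamiltonianCycle) ∧
      (∀ i j, i ≠ j → Disjoint (c i).edgeSet (c j).edgeSet) ∧
      IsKConnected (G.deleteEdges (⋃ i, (c i).edgeSet)) k := by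
  have hd := Finset.disjoint_left.1 h.disjoint_left
  -- A cover with fewer than `k - |X|` vertices would, together with `X`, separate the sides in `G`.
  obtain ⟨M, f, hML, hMc, hinj, hf⟩ := exists_matching_of_le_cover (G := G) (L := A ∪ SA)
    (R := B ∪ SB) (r := k - X.card) (by
      intro C hC
      by_contra hlt
      obtain ⟨y, hy, z, hz, hyT, hzT, hyz⟩ := h.exists_adj hG (T := C ∪ X) (by
        have := Finset.card_union_le C X
        omega) Finset.subset_union_right
      rw [Finset.mem_union, not_or] at hyT hzT
      exact (hC y hy z hz hyz).elim hyT.1 hzT.1)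
  set Z : SimpleGraph V := fromRel fun a b => a ∈ M ∧ b = f a with hZdef
  have hZ' : ∀ a b, Z.Adj a b → (a ∈ M ∧ b = f a) ∨ (b ∈ M ∧ a = f b) := fun a b hab => hab.2
  have hZ : ∀ a b, Z.Adj a b → (a ∈ A ∪ SA ∧ b ∈ B ∪ SB) ∨ (b ∈ A ∪ SA ∧ a ∈ B ∪ SB) := by
    intro a b hab
    rcases hZ' a b hab with ⟨ha, rfl⟩ | ⟨hb, rfl⟩
    · exact Or.inl ⟨hML ha, (hf a ha).1⟩
    · exact Or.inr ⟨hML hb, (hf b hb).1⟩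
  have hZL : (Z.touched (A ∪ SA) (B ∪ SB)).card ≤ k := by
    refine le_trans (Finset.card_le_card (t := M) fun a ha => ?_) (by omega)
    obtain ⟨ha, b, hb, hab⟩ := mem_touched.1 ha
    rcases hZ' a b hab with ⟨ha, rfl⟩ | ⟨hb', rfl⟩
    · exact ha
    · exact absurd hb (hd (hML hb'))
  have hZR : (Z.touched (B ∪ SB) (A ∪ SA)).card ≤ k := by
    refine le_trans (Finset.card_le_card (t := M.image f) fun a ha => ?_)
      (Finset.card_image_le.trans (by omega))
    obtain ⟨ha, b, hb, hab⟩ := mem_touched.1 ha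
    rcases hZ' a b hab with ⟨ha', rfl⟩ | ⟨hb', rfl⟩
    · exact absurd ha (hd (hML ha'))
    · exact Finset.mem_image_of_mem f hb'
  refine h.exists_hamiltonianCycles hZ
    (fun D j hj hD => h.exists_connector hX hSA hSB hZ hZL hZR hD hj) fun D hD T hT => ?_
  by_cases hXT : X ⊆ T
  · right
    by_contra hcon
    push Not at hcon
    -- If `T` met every matching edge, sending each edge to an end in `T` would embed `k - |X|`
    -- edges into `T \ X`, which has fewer elements.
    let g : V → V := fun a => if a ∈ T then a else f a
    have hg : ∀ a ∈ M, g a ∈ T \ X := by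
      intro a ha
      simp only [g]
      split_ifs with haT
      · rw [Finset.mem_sdiff]
        exact ⟨haT, fun haX => ((h.mem_X_iff a).1 haX).1 (hML ha)⟩
      · rw [Finset.mem_sdiff]
        refine ⟨?_, fun haX => ((h.mem_X_iff _).1 haX).2 (hf a ha).1⟩
        by_contra hfT
        refine hcon a (hML ha) (f a) (hf a ha).1 haT hfT ⟨(hf a ha).2, hD.reserved _ _ ?_⟩
        exact ⟨(hf a ha).2.ne, Or.inl ⟨ha, rfl⟩⟩
    have hginj : Set.InjOn g M := by
      intro a ha b hb hab
      simp only [g] at hab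
      split_ifs at hab
      · exact hab
      · exact absurd (hf b hb).1 (hab ▸ hd (hML ha))
      · exact absurd (hf a ha).1 (hab ▸ hd (hML hb))
      · exact hinj ha hb hab
    have e1 := Finset.card_le_card_of_injOn g hg hginj
    have e2 := Finset.card_sdiff_add_card_eq_card hXT
    omega
  · rw [Finset.not_subset] at hXT
    obtain ⟨x, hx, hxT⟩ := hXT
    exact Or.inl ⟨x, hxT, h.le_degIn_of_mem_X hD hx⟩

end SimpleGraph

/-! ### The theorem. -/

open SimpleGraph

theorem theorem4p3 {V : Type*} [Fintype V] [DecidableEq V]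
    (G : SimpleGraph V) [DecidableRel G.Adj] (k p q : ℕ)
    (hk : 2 ≤ k) (hp : 1 ≤ p) (hq : 1 ≤ q)
    (hG : IsKConnected G k)
    (hδ : (Fintype.card V : ℚ) / 2 ≤ (G.minDegree : ℚ))
    (hn : max
        (6 * ((k : ℤ) + (p : ℤ)) + 8 * ((q : ℤ) - 1) - 2 * ⌈((k : ℚ) - 2) / (k : ℚ)⌉)
        ((k : ℤ) * ((q : ℤ) + 3) + max (((k : ℤ) - 2) * (q : ℤ) - 2) (2 * (p : ℤ))
          + 2 * max (p : ℤ) (q : ℤ) - 4)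
      ≤ (Fintype.card V : ℤ)) :
    (∀ (H : SimpleGraph V) [DecidableRel H.Adj], H ≤ G → H.maxDegree ≤ p →
      IsKConnected (G.deleteEdges H.edgeSet) k) ∨
    (∃ (a : Fin q → V) (c : (i : Fin q) → G.Walk (a i) (a i)),
      (∀ i, (c i).IsHamiltonianCycle) ∧
      (∀ i j, i ≠ j → Disjoint (c i).edgeSet (c j).edgeSet) ∧
      IsKConnected (G.deleteEdges (⋃ i, (c i).edgeSet)) k) := by
  classical
  by_cases hall : ∀ (H : SimpleGraph V) [DecidableRel H.Adj], H ≤ G → H.maxDegree ≤ p →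
      IsKConnected (G.deleteEdges H.edgeSet) k
  · exact Or.inl hall
  right
  push Not at hall
  obtain ⟨H, hHdec, -, hHp, hH⟩ := hall
  -- The rounded-up quotient is at most `1`, so the constants `8` and `2` combine to `10`.
  have hlarge : 6 * k + 6 * p + 8 * q ≤ Fintype.card V + 10 := by
    have h1 := (le_max_left _ _).trans hn
    have h2 : ⌈((k : ℚ) - 2) / (k : ℚ)⌉ ≤ 1 := by
      rw [Int.ceil_le, Int.cast_one]
      have : (0 : ℚ) < k := by exact_mod_cast (by omega : 0 < k)
      rw [div_le_one this]
      linarith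
    omega
  have hdeg : ∀ v, Fintype.card V ≤ 2 * G.degIn Finset.univ v := by
    intro v
    have h1 : G.degIn Finset.univ v = G.degree v := by
      rw [degIn, ← card_neighborFinset_eq_degree]
      congr 1
      ext w
      simp
    have h2 : Fintype.card V ≤ 2 * G.minDegree := by
      have : (Fintype.card V : ℚ) ≤ 2 * G.minDegree := by linarith
      exact_mod_cast this
    have := G.minDegree_le_degree v
    omega
  rw [deleteEdges, fromEdgeSet_edgeSet] at hH
  obtain ⟨A, B, S, hAB, hAS, hBS, hmem, hS, hA, hB, hcA, hcB⟩ :=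
    exists_separation hHp hG.1 hH
  set S₀ := S.filter fun x => k + q ≤ G.degIn A x ∧ k + q ≤ G.degIn B x with hS₀
  have hS₀S : S₀ ⊆ S := Finset.filter_subset _ _
  -- `X` may be any part of `S₀`: in the second case two vertices suffice, and the rest of `S₀` is
  -- attached to the clusters.
  have hlay : ∀ X ⊆ S₀, Layout G k p q A B
      ((S \ X).filter fun x => G.degIn B x ≤ G.degIn A x)
      ((S \ X).filter fun x => ¬ G.degIn B x ≤ G.degIn A x) X := fun X hX =>
    layout_of_separation hk hp hq hlarge hdeg hAB hAS hBS hmem hS hA hB hcA hcB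
      (hX.trans hS₀S) fun x hx => (Finset.mem_filter.1 (hX hx)).2
  rcases le_or_gt S₀.card 1 with hc | hc
  · have hout : ∀ x ∈ S \ S₀, G.degIn A x < k + q ∨ G.degIn B x < k + q := by
      intro x hx
      obtain ⟨hx1, hx2⟩ := Finset.mem_sdiff.1 hx
      by_contra hcon
      exact hx2 (Finset.mem_filter.2 ⟨hx1, by omega⟩)
    refine (hlay S₀ subset_rfl).exists_hamiltonianCycles_of_card_le hG hc ?_ ?_
    · intro x hx
      obtain ⟨hx1, hx2⟩ := Finset.mem_filter.1 hx
      have := hout x hx1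
      omega
    · intro x hx
      obtain ⟨hx1, hx2⟩ := Finset.mem_filter.1 hx
      have := hout x hx1
      omega
  · obtain ⟨x₁, hx₁, x₂, hx₂, hne⟩ := Finset.one_lt_card.1 hc
    exact (hlay {x₁, x₂} (by
      intro x hx
      rcases Finset.mem_insert.1 hx with rfl | hx
      · exact hx₁
      · rwa [Finset.mem_singleton.1 hx])).exists_hamiltonianCycles_of_pair hne hG
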